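/- **Setting.** Let $V:\mathbb R\to\mathbb R$ be smooth and even, with $V=V_{\rm per}+V_{\rm def}$, where $V_{\rm per}(x+1)=V_{\rm per}(x)$ for all $x$ and $V_{\rm def}(x)=0$ for $|x|>\rho$, for some $\rho\ge 0$. Let $\Phi\in L^2(\mathbb R)$, $\Phi\neq0$, be a bound state $-\Phi''+V\Phi=E\Phi$ with $E<0$; $\Phi$ is then either even or odd. For $z\in\mathbb C$ let $u_z,v_z$ be the solutions of $-y''+Vy=zy$ with $$u_z(0)=1,\ u_z'(0)=0,\ v_z(0)=0,\ v_z'(0)=1\quad\text{if }\Phi\text{ is even},$$ $$u_z(0)=0,\ u_z'(0)=1,\ v_z(0)=-1,\ v_z'(0)=0\quad\text{if }\Phi\text{ is odd}.$$ For $M>0$ and $z\in\mathbb C\setminus[0,\infty)$ let $\Theta(z)=\Theta_M(z)=u_z'(M)-i\sqrt z\,u_z(M)$, with the branch $\operatorname{Im}\sqrt z>0$. Let $H_{\rm trunc}=-\partial_x^2+V_{\rm trunc}$ on $L^2(\mathbb R)$, where $V_{\rm trunc}=V$ for $|x|\le M$ and $V_{\rm trunc}=0$ for $|x|>M$. **Theorem.**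 There is $k>0$ such that for every $\delta>0$ there are $M_0>\rho$ and $C$ such that for every $M\ge M_0$ satisfying the (uniform) nondegeneracy condition $$\bigl|v_E'(M)-i\sqrt E\,v_E(M)\bigr|\ \ge\ \delta\,\bigl(|v_E(M)|+|v_E'(M)|\bigr)$$ the following hold. 1. $\Theta$ has a unique root $E^*$ in the ball $\{z\in\mathbb C:\ |z-E|\le M^{-2}e^{-kM}\}$. 2. The root $E^*$ is real and negative, and it is an eigenvalue of $H_{\rm trunc}$. Moreover $\Theta$ is complex differentiable at $E$ with $\partial_z\Theta(E)\ne0$, and $$\Bigl|E^*-\Bigl(E-\frac{\Theta(E)}{\partial_z\Theta(E)}\Bigr)\Bigr|\le C\,e^{-4kM}.$$ -/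

import Mathlib

/-- `y` is the classical solution on `ℝ` of `(D_x² + V - z) y = 0`, that is `-y'' + V y = z y`,
with `y 0 = a` and `y' 0 = b`. -/
structure IsSchrodingerIVP (V : ℝ → ℝ) (z a b : ℂ) (y : ℝ → ℂ) : Prop where
  differentiable : Differentiable ℝ y
  differentiable_deriv : Differentiable ℝ (deriv y)
  equation : ∀ x, -deriv (deriv y) x + (V x : ℂ) * y x = z * y x
  value_zero : y 0 = a
  deriv_zero : deriv y 0 = b

/-- The terms of the Picard series of the initial value problem. -/
noncomputable def picardTerm (V : ℝ → ℝ) (z a b : ℂ) : ℕ → ℝ → ℂ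
  | 0 => fun x => a + b * x
  | n + 1 => fun x => ∫ s in (0 : ℝ)..x, ∫ t in (0 : ℝ)..s, ((V t : ℂ) - z) * picardTerm V z a b n t

/-- The derivatives of the terms of the Picard series. -/
noncomputable def picardTermDeriv (V : ℝ → ℝ) (z a b : ℂ) : ℕ → ℝ → ℂ
  | 0 => fun _ => b
  | n + 1 => fun s => ∫ t in (0 : ℝ)..s, ((V t : ℂ) - z) * picardTerm V z a b n t

/-- The second derivatives of the terms of the Picard series. -/
noncomputable def picardTermDeriv2 (V : ℝ → ℝ) (z a b : ℂ) : ℕ → ℝ → ℂ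
  | 0 => fun _ => 0
  | n + 1 => fun t => ((V t : ℂ) - z) * picardTerm V z a b n t

theorem continuous_picardTerm {V : ℝ → ℝ} (hV : Continuous V) (z a b : ℂ) (n : ℕ) :
    Continuous (picardTerm V z a b n) := by
  induction n with
  | zero => unfold picardTerm; fun_prop
  | succ n ih =>
    have h1 : Continuous fun t => ((V t : ℂ) - z) * picardTerm V z a b n t := by fun_prop
    have h2 : Continuous fun s => ∫ t in (0 : ℝ)..s, ((V t : ℂ) - z) * picardTerm V z a b n t :=
      intervalIntegral.continuous_primitive (fun _ _ => h1.intervalIntegrable _ _) 0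
    exact intervalIntegral.continuous_primitive (fun _ _ => h2.intervalIntegrable _ _) 0

theorem hasDerivAt_picardTermDeriv {V : ℝ → ℝ} (hV : Continuous V) (z a b : ℂ) (n : ℕ) (x : ℝ) :
    HasDerivAt (picardTermDeriv V z a b n) (picardTermDeriv2 V z a b n x) x := by
  cases n with
  | zero => exact hasDerivAt_const x b
  | succ n =>
    have h0 := continuous_picardTerm hV z a b n
    have h1 : Continuous fun t => ((V t : ℂ) - z) * picardTerm V z a b n t := by fun_prop
    exact intervalIntegral.integral_hasDerivAt_right (h1.intervalIntegrable _ _)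
      (h1.stronglyMeasurableAtFilter _ _) h1.continuousAt

theorem hasDerivAt_picardTerm {V : ℝ → ℝ} (hV : Continuous V) (z a b : ℂ) (n : ℕ) (x : ℝ) :
    HasDerivAt (picardTerm V z a b n) (picardTermDeriv V z a b n x) x := by
  cases n with
  | zero =>
    have h : HasDerivAt (fun x : ℝ => (x : ℂ)) 1 x := Complex.ofRealCLM.hasDerivAt
    simpa [picardTerm, picardTermDeriv] using (h.const_mul b).const_add a
  | succ n =>
    have h1 : Continuous (picardTermDeriv V z a b (n + 1)) :=
      continuous_iff_continuousAt.2 fun x => (hasDerivAt_picardTermDeriv hV z a b (n + 1) x).continuousAt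
    exact intervalIntegral.integral_hasDerivAt_right (h1.intervalIntegrable _ _)
      (h1.stronglyMeasurableAtFilter _ _) h1.continuousAt

theorem norm_primitive_le {f : ℝ → ℂ} {R B : ℝ} {n : ℕ}
    (hB : ∀ t, |t| ≤ R → ‖f t‖ ≤ B * |t| ^ n) {x : ℝ} (hx : |x| ≤ R) :
    ‖∫ t in (0 : ℝ)..x, f t‖ ≤ B * (|x| ^ (n + 1) / (n + 1)) := by
  rw [intervalIntegral.norm_integral_eq_norm_integral_uIoc]
  have h2 : ∫ t in Set.uIoc 0 x, B * |t - 0| ^ n = B * (|x - 0| ^ (n + 1) / (n + 1)) := by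
    rw [MeasureTheory.integral_const_mul, integral_pow_abs_sub_uIoc]
  simp only [sub_zero] at h2
  rw [← h2]
  have hint : MeasureTheory.IntegrableOn (fun t : ℝ => B * |t| ^ n) (Set.uIoc 0 x) := by
    have hc : Continuous fun t : ℝ => B * |t| ^ n := by fun_prop
    exact (intervalIntegrable_iff.1 (hc.intervalIntegrable 0 x))
  refine MeasureTheory.norm_integral_le_of_norm_le hint ?_
  refine (MeasureTheory.ae_restrict_iff' measurableSet_uIoc).2 (Filter.Eventually.of_forall ?_)
  intro t ht
  apply hB
  have := Set.abs_sub_left_of_mem_uIcc (Set.uIoc_subset_uIcc ht)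
  simp only [sub_zero] at this
  exact this.trans hx

theorem norm_picardTerm_le {V : ℝ → ℝ} {z : ℂ} (a b : ℂ) {R K : ℝ}
    (hR : 0 ≤ R) (hK : 0 ≤ K) (hVK : ∀ t, |t| ≤ R → ‖(V t : ℂ) - z‖ ≤ K) (n : ℕ) {x : ℝ}
    (hx : |x| ≤ R) :
    ‖picardTerm V z a b n x‖ ≤ (‖a‖ + ‖b‖ * R) * ((K * R) ^ n / n.factorial) * |x| ^ n := by
  induction n generalizing x with
  | zero =>
    simp only [picardTerm, pow_zero, Nat.factorial_zero, Nat.cast_one, div_one, mul_one]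
    refine (norm_add_le _ _).trans ?_
    rw [norm_mul, Complex.norm_real, Real.norm_eq_abs]
    gcongr
  | succ n ih =>
    have h1 : ∀ s, |s| ≤ R → ‖∫ t in (0 : ℝ)..s, ((V t : ℂ) - z) * picardTerm V z a b n t‖ ≤
        (K * R * ((‖a‖ + ‖b‖ * R) * ((K * R) ^ n / n.factorial))) * |s| ^ n := by
      intro s hs
      refine (norm_primitive_le (R := R) (n := n)
        (B := K * ((‖a‖ + ‖b‖ * R) * ((K * R) ^ n / n.factorial))) ?_ hs).trans ?_
      · intro t ht
        rw [norm_mul, mul_assoc]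
        gcongr
        · exact hVK t ht
        · exact ih ht
      · have h3 : |s| ^ (n + 1) / ((n : ℝ) + 1) ≤ R * |s| ^ n := by
          rw [div_le_iff₀ (by positivity), pow_succ]
          have h4 : |s| ^ n * |s| ≤ |s| ^ n * R := by gcongr
          have h5 : 0 ≤ R * |s| ^ n * n := by positivity
          nlinarith
        calc _ ≤ K * ((‖a‖ + ‖b‖ * R) * ((K * R) ^ n / n.factorial)) * (R * |s| ^ n) := by gcongr
          _ = _ := by ring
    refine (norm_primitive_le h1 hx).trans (le_of_eq ?_)
    rw [Nat.factorial_succ]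
    push_cast
    field_simp
    rw [pow_succ (K * R) n]
    ring

theorem exists_isSchrodingerIVP {V : ℝ → ℝ} (hV : Continuous V) (z a b : ℂ) :
    ∃ y, IsSchrodingerIVP V z a b y := by
  have key : ∀ x : ℝ, Summable (fun n => picardTerm V z a b n x) ∧
      HasDerivAt (fun x => ∑' n, picardTerm V z a b n x) (∑' n, picardTermDeriv V z a b n x) x ∧
      HasDerivAt (fun x => ∑' n, picardTermDeriv V z a b n x)
        (∑' n, picardTermDeriv2 V z a b n x) x := by
    intro x
    obtain ⟨R, hR⟩ : ∃ R, R = |x| + 1 := ⟨_, rfl⟩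
    have hR0 : 0 < R := by rw [hR]; positivity
    obtain ⟨K, hK⟩ : ∃ K, ∀ t ∈ Set.Icc (-R) R, ‖(V t : ℂ) - z‖ ≤ K :=
      isCompact_Icc.exists_bound_of_continuousOn (by fun_prop)
    have hVK : ∀ t, |t| ≤ R → ‖(V t : ℂ) - z‖ ≤ K := fun t ht => hK t (abs_le.1 ht)
    have hK0 : 0 ≤ K := (norm_nonneg _).trans (hVK 0 (by simp [hR0.le]))
    have hbd : ∀ n, ∀ t, |t| ≤ R → ‖picardTerm V z a b n t‖ ≤
        (‖a‖ + ‖b‖ * R) * ((K * R * R) ^ n / n.factorial) := by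
      intro n t ht
      refine (norm_picardTerm_le a b hR0.le hK0 hVK n ht).trans ?_
      calc _ ≤ (‖a‖ + ‖b‖ * R) * ((K * R) ^ n / n.factorial) * R ^ n := by gcongr
        _ = _ := by rw [mul_pow (K * R) R n]; ring
    have hsum : Summable fun n : ℕ =>
        (‖a‖ + ‖b‖ * R) * ((K * R * R) ^ n / n.factorial) :=
      (Real.summable_pow_div_factorial _).mul_left _
    have hbd2 : ∀ n, ∀ t, |t| ≤ R → ‖picardTermDeriv2 V z a b (n + 1) t‖ ≤
        K * ((‖a‖ + ‖b‖ * R) * ((K * R * R) ^ n / n.factorial)) := by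
      intro n t ht
      simp only [picardTermDeriv2, norm_mul]
      exact mul_le_mul (hVK t ht) (hbd n t ht) (norm_nonneg _) hK0
    have hbd1 : ∀ n, ∀ t, |t| ≤ R → ‖picardTermDeriv V z a b (n + 1) t‖ ≤
        R * (K * ((‖a‖ + ‖b‖ * R) * ((K * R * R) ^ n / n.factorial))) := by
      intro n t ht
      have h := norm_primitive_le (R := R) (n := 0) (f := picardTermDeriv2 V z a b (n + 1))
        (B := K * ((‖a‖ + ‖b‖ * R) * ((K * R * R) ^ n / n.factorial)))
        (fun t ht => by simpa using hbd2 n t ht) ht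
      refine h.trans ?_
      simp only [zero_add, pow_one, Nat.cast_zero, div_one]
      rw [mul_comm]
      gcongr
    have hxm : x ∈ Set.Ioo (-R) R := abs_lt.1 (by rw [hR]; linarith)
    have habs : ∀ {t}, t ∈ Set.Ioo (-R) R → |t| ≤ R := fun ht => (abs_lt.2 ht).le
    have hs1 : Summable (Nat.rec ‖b‖ fun n _ =>
        R * (K * ((‖a‖ + ‖b‖ * R) * ((K * R * R) ^ n / n.factorial))) : ℕ → ℝ) :=
      (summable_nat_add_iff 1).1 ((hsum.mul_left K).mul_left R)
    have hs2 : Summable (Nat.rec 0 fun n _ =>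
        K * ((‖a‖ + ‖b‖ * R) * ((K * R * R) ^ n / n.factorial)) : ℕ → ℝ) :=
      (summable_nat_add_iff 1).1 (hsum.mul_left K)
    have hsx : Summable fun n => picardTerm V z a b n x :=
      .of_norm_bounded hsum fun n => hbd n x (habs hxm)
    have hle1 : ∀ n t, t ∈ Set.Ioo (-R) R → ‖picardTermDeriv V z a b n t‖ ≤
        (Nat.rec ‖b‖ fun n _ =>
          R * (K * ((‖a‖ + ‖b‖ * R) * ((K * R * R) ^ n / n.factorial))) : ℕ → ℝ) n := by
      intro n t ht
      cases n with
      | zero => simp [picardTermDeriv]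
      | succ n => exact hbd1 n t (habs ht)
    have hle2 : ∀ n t, t ∈ Set.Ioo (-R) R → ‖picardTermDeriv2 V z a b n t‖ ≤
        (Nat.rec 0 fun n _ =>
          K * ((‖a‖ + ‖b‖ * R) * ((K * R * R) ^ n / n.factorial)) : ℕ → ℝ) n := by
      intro n t ht
      cases n with
      | zero => simp [picardTermDeriv2]
      | succ n => exact hbd2 n t (habs ht)
    refine ⟨hsx, ?_, ?_⟩
    · exact hasDerivAt_tsum_of_isPreconnected hs1 isOpen_Ioo isPreconnected_Ioo
        (fun n t _ => hasDerivAt_picardTerm hV z a b n t) hle1 hxm hsx hxm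
    · exact hasDerivAt_tsum_of_isPreconnected hs2 isOpen_Ioo isPreconnected_Ioo
        (fun n t _ => hasDerivAt_picardTermDeriv hV z a b n t) hle2 hxm
        (.of_norm_bounded hs1 fun n => hle1 n x hxm) hxm
  have hd : deriv (fun x => ∑' n, picardTerm V z a b n x) =
      fun x => ∑' n, picardTermDeriv V z a b n x := funext fun x => (key x).2.1.deriv
  refine ⟨fun x => ∑' n, picardTerm V z a b n x, fun x => (key x).2.1.differentiableAt, ?_, ?_,
    ?_, ?_⟩
  · rw [hd]
    exact fun x => (key x).2.2.differentiableAt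
  · intro x
    rw [hd, (key x).2.2.deriv]
    have h : ∑' n, picardTermDeriv2 V z a b n x =
        ((V x : ℂ) - z) * ∑' n, picardTerm V z a b n x := by
      have hs : Summable fun n => picardTermDeriv2 V z a b n x :=
        (summable_nat_add_iff 1).1 ((key x).1.mul_left ((V x : ℂ) - z))
      rw [hs.tsum_eq_zero_add, ← tsum_mul_left]
      simp [picardTermDeriv2]
    rw [h]
    ring
  · rw [(key 0).1.tsum_eq_zero_add]
    simp [picardTerm]
  · rw [hd]
    change ∑' n, picardTermDeriv V z a b n 0 = b
    rw [tsum_eq_single 0]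
    · rfl
    · intro n hn
      obtain ⟨m, rfl⟩ := Nat.exists_eq_succ_of_ne_zero hn
      simp [picardTermDeriv]

theorem IsSchrodingerIVP.unique {V : ℝ → ℝ} (hV : Continuous V) {z a b : ℂ} {y w : ℝ → ℂ}
    (hy : IsSchrodingerIVP V z a b y) (hw : IsSchrodingerIVP V z a b w) : y = w := by
  have hasD : ∀ {f : ℝ → ℂ}, IsSchrodingerIVP V z a b f → ∀ t,
      HasDerivAt (fun t => (f t, deriv f t))
        ((fun (t : ℝ) (p : ℂ × ℂ) => (p.2, ((V t : ℂ) - z) * p.1)) t (f t, deriv f t)) t := by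
    intro f hf t
    have h2 : deriv (deriv f) t = ((V t : ℂ) - z) * f t := by
      have := hf.equation t
      linear_combination -this
    have := (hf.differentiable t).hasDerivAt.prodMk (hf.differentiable_deriv t).hasDerivAt
    rw [h2] at this
    exact this
  funext x
  obtain ⟨R, hR⟩ : ∃ R, R = |x| + 1 := ⟨_, rfl⟩
  have hR0 : 0 < R := by rw [hR]; positivity
  obtain ⟨K, hK⟩ : ∃ K, ∀ t ∈ Set.Icc (-R) R, ‖(V t : ℂ) - z‖ ≤ K :=
    isCompact_Icc.exists_bound_of_continuousOn (by fun_prop)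
  have hlip : ∀ t ∈ Set.Ioo (-R) R, LipschitzOnWith (max 1 K.toNNReal)
      ((fun (t : ℝ) (p : ℂ × ℂ) => (p.2, ((V t : ℂ) - z) * p.1)) t) Set.univ := by
    intro t ht
    refine LipschitzOnWith.of_dist_le_mul fun p _ q _ => ?_
    have h1 : dist p.2 q.2 ≤ dist p q := le_max_right _ _
    have h2 : dist p.1 q.1 ≤ dist p q := le_max_left _ _
    have h3 : ((max 1 K.toNNReal : NNReal) : ℝ) = max 1 (max K 0) := by
      simp [Real.coe_toNNReal']
    rw [h3]
    refine max_le ?_ ?_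
    · exact h1.trans (le_mul_of_one_le_left dist_nonneg (le_max_left _ _))
    · simp only [dist_eq_norm] at h2 ⊢
      rw [← mul_sub, norm_mul]
      refine mul_le_mul ((hK t (Set.Ioo_subset_Icc_self ht)).trans ?_) h2 (norm_nonneg _)
        (by positivity)
      exact (le_max_left _ _).trans (le_max_right _ _)
  have hxm : x ∈ Set.Ioo (-R) R := abs_lt.1 (by rw [hR]; linarith)
  have h := ODE_solution_unique_of_mem_Ioo (t₀ := 0) hlip ⟨by linarith, hR0⟩
    (fun t _ => ⟨hasD hy t, Set.mem_univ _⟩) (fun t _ => ⟨hasD hw t, Set.mem_univ _⟩)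
    (by rw [hy.value_zero, hy.deriv_zero, hw.value_zero, hw.deriv_zero]) hxm
  exact congrArg Prod.fst h

open Classical in
/-- The solution of `-y'' + V y = z y` with `y 0 = a`, `y' 0 = b`; for continuous `V` it exists and
is unique, by the two theorems above. -/
noncomputable def schrodingerSol (V : ℝ → ℝ) (z a b : ℂ) : ℝ → ℂ :=
  if h : ∃ y, IsSchrodingerIVP V z a b y then h.choose else 0

theorem schrodingerSol_spec {V : ℝ → ℝ} (hV : Continuous V) (z a b : ℂ) :
    IsSchrodingerIVP V z a b (schrodingerSol V z a b) := by
  have h := exists_isSchrodingerIVP hV z a b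
  rw [schrodingerSol, dif_pos h]
  exact h.choose_spec

/-- The potential is smooth and is the sum of a `1`-periodic function and a function that vanishes
for `|x| > ρ`. -/
structure IsDefectPotential (V : ℝ → ℝ) (ρ : ℝ) : Prop where
  smooth : ContDiff ℝ (⊤ : ℕ∞) V
  radius_nonneg : 0 ≤ ρ
  decomposition : ∃ Vper Vdef : ℝ → ℝ, (∀ x, V x = Vper x + Vdef x) ∧
    (∀ x, Vper (x + 1) = Vper x) ∧ ∀ x, ρ < |x| → Vdef x = 0

/-- `Ψ` is a bound state, with eigenvalue `lam`, of `D_x² + W` acting on `L²(ℝ)`: it is a nonzero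
element of `L²(ℝ)`, it is differentiable, and its derivative is the primitive of `(W - lam) Ψ`,
so that `-Ψ'' + W Ψ = lam Ψ` almost everywhere. For bounded measurable `W` these are the
eigenfunctions of the self-adjoint operator with domain `H²(ℝ)`; for continuous `W` they are
classical solutions. -/
structure IsBoundState (W : ℝ → ℝ) (lam : ℝ) (Ψ : ℝ → ℂ) : Prop where
  memLp : MeasureTheory.MemLp Ψ 2 MeasureTheory.volume
  ne_zero : Ψ ≠ 0
  differentiable : Differentiable ℝ Ψ
  integrable : ∀ x y : ℝ, IntervalIntegrable (fun t => ((W t : ℂ) - lam) * Ψ t)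
    MeasureTheory.volume x y
  equation : ∀ x y : ℝ, deriv Ψ y - deriv Ψ x = ∫ t in x..y, ((W t : ℂ) - lam) * Ψ t

open Classical in
/-- The truncated potential: `V` for `|x| ≤ M` and `0` for `|x| > M`. -/
noncomputable def truncPotential (V : ℝ → ℝ) (M : ℝ) : ℝ → ℝ :=
  fun x => if |x| ≤ M then V x else 0

open Classical in
/-- `u_z`: the solution with `u_z 0 = 1`, `u_z' 0 = 0` if the bound state `Φ` is even, and with
`u_z 0 = 0`, `u_z' 0 = 1` otherwise (for even `V` a bound state is either even or odd). -/
noncomputable def uSol (V : ℝ → ℝ) (Φ : ℝ → ℂ) (z : ℂ) : ℝ → ℂ :=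
  if ∀ x, Φ (-x) = Φ x then schrodingerSol V z 1 0 else schrodingerSol V z 0 1

open Classical in
/-- `v_z`: the solution with `v_z 0 = 0`, `v_z' 0 = 1` if the bound state `Φ` is even, and with
`v_z 0 = -1`, `v_z' 0 = 0` otherwise. -/
noncomputable def vSol (V : ℝ → ℝ) (Φ : ℝ → ℂ) (z : ℂ) : ℝ → ℂ :=
  if ∀ x, Φ (-x) = Φ x then schrodingerSol V z 0 1 else schrodingerSol V z (-1) 0

/-- The branch of the square root on `ℂ ∖ [0, ∞)` with positive imaginary part. -/
noncomputable def sqrtUpper (z : ℂ) : ℂ := Complex.I * (-z) ^ (1 / 2 : ℂ)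

theorem sqrtUpper_sq (z : ℂ) : sqrtUpper z ^ 2 = z := by
  have h : ((-z) ^ (1 / 2 : ℂ)) ^ 2 = -z := by
    rw [one_div]
    exact_mod_cast Complex.cpow_nat_inv_pow (-z) (n := 2) two_ne_zero
  rw [sqrtUpper, mul_pow, h, Complex.I_sq]
  ring

theorem sqrtUpper_im_pos {z : ℂ} (hz : -z ∈ Complex.slitPlane) : 0 < (sqrtUpper z).im := by
  have h0 : -z ≠ 0 := Complex.slitPlane_ne_zero hz
  have harg : Complex.arg (-z) ≠ Real.pi := (Complex.mem_slitPlane_iff_arg.1 hz).1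
  have h1 := Complex.neg_pi_lt_arg (-z)
  have h2 := lt_of_le_of_ne (Complex.arg_le_pi (-z)) harg
  have h3 : (sqrtUpper z).im = ((-z) ^ (1 / 2 : ℂ)).re := by simp [sqrtUpper]
  have h4 : (Complex.log (-z) * (1 / 2)).im = Complex.arg (-z) / 2 := by
    rw [Complex.mul_im]
    simp [Complex.log_im]
    ring
  rw [h3, Complex.cpow_def_of_ne_zero h0, Complex.exp_re, h4]
  exact mul_pos (Real.exp_pos _) (Real.cos_pos_of_mem_Ioo ⟨by linarith, by linarith⟩)

/-- `Θ(z) = u_z'(M) - i √z u_z(M)`. -/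
noncomputable def Theta (V : ℝ → ℝ) (Φ : ℝ → ℂ) (M : ℝ) (z : ℂ) : ℂ :=
  deriv (uSol V Φ z) M - Complex.I * sqrtUpper z * uSol V Φ z M

/-! Since `-i √z = (-z)^(1/2)`, a root of `Θ` is an energy at which `u_z` meets, at `M`, the tail
decaying like `exp (-(-z)^(1/2) x)`. For a negative real root, parity gives the same match at `-M`,
and gluing the tails produces an eigenfunction (`exists_isBoundState_truncPotential`). It remains to
find the root near `E`.

At `E` the solution `u` is square integrable and `V` is eventually periodic. Hence `u` is a Floquet
solution with multiplier of modulus `exp (-lam) < 1`, and the second solution `v` grows at most like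
`exp (lam x)` (`IsFundamentalPair.exists_hasDichotomy`). So `Θ(E) = O(exp (-lam M))`. Variation of
constants gives `Θ'(E) = (u' + κ u) ∫ v u + κ' u - (v' + κ v) ∫ u²`, with `κ = (-E)^(1/2)` and `κ' =
d/dz (-z)^(1/2)` at `E`. The first two terms are `O(M exp (-lam M))`. The last is at least a
constant times `δ exp (lam M)`: the Wronskian forces `v` to be large, nondegeneracy passes this to
`v' + κ v`, and `u` is real, so `∫ u²` cannot cancel.

The Volterra equation shows that for `|z - E|` below a multiple of `1/M` the solution `u_z` still
grows at most like `exp (lam x)` on `[0, M]` (`HasDichotomy.norm_le`). Cauchy's estimate then gives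
`Θ'' = O(M² exp (lam M))` near `E`. With `k = lam / 2`, which does not depend on `δ`, and `X = exp
(k M)`, the sizes of `Θ`, `Θ'`, `Θ''` are at most `X⁻²`, at least `X²`, and at most `M² X²`, up to
constants. The contraction argument `exists_unique_root_near` thus works on radius `M⁻² X⁻¹`, with
Newton error `O(M² X⁻⁸)`. The root is real because `Θ` commutes with conjugation and the root is
unique. -/

section SchrodingerODE

open Set Filter Topology

/-! ### Solutions, Wronskians and dependence on the spectral parameter. -/

namespace IsSchrodingerIVP

variable {V : ℝ → ℝ} {z a b : ℂ} {y : ℝ → ℂ}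

theorem hasDerivAt (hy : IsSchrodingerIVP V z a b y) (x : ℝ) : HasDerivAt y (deriv y x) x :=
  (hy.differentiable x).hasDerivAt

theorem hasDerivAt_deriv (hy : IsSchrodingerIVP V z a b y) (x : ℝ) :
    HasDerivAt (deriv y) (((V x : ℂ) - z) * y x) x := by
  have h := (hy.differentiable_deriv x).hasDerivAt
  have h2 : deriv (deriv y) x = ((V x : ℂ) - z) * y x := by
    linear_combination -(hy.equation x)
  rwa [h2] at h

theorem continuous (hy : IsSchrodingerIVP V z a b y) : Continuous y :=
  hy.differentiable.continuous

theorem continuous_deriv (hy : IsSchrodingerIVP V z a b y) : Continuous (deriv y) :=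
  hy.differentiable_deriv.continuous

theorem of_hasDerivAt {y' : ℝ → ℂ} (h : ∀ x, HasDerivAt y (y' x) x)
    (h' : ∀ x, HasDerivAt y' (((V x : ℂ) - z) * y x) x) (ha : y 0 = a) (hb : y' 0 = b) :
    IsSchrodingerIVP V z a b y := by
  have hd : deriv y = y' := funext fun x => (h x).deriv
  refine ⟨fun x => (h x).differentiableAt, ?_, ?_, ha, by rw [hd, hb]⟩
  · rw [hd]; exact fun x => (h' x).differentiableAt
  · intro x
    rw [hd, (h' x).deriv]
    ring

/-- The Wronskian of solutions with spectral parameters `z` and `z'`. -/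
theorem wronskian_eq {z' a' b' : ℂ} {w : ℝ → ℂ}
    (hy : IsSchrodingerIVP V z a b y) (hw : IsSchrodingerIVP V z' a' b' w) (x : ℝ) :
    y x * deriv w x - deriv y x * w x =
      (a * b' - b * a') + (z - z') * ∫ t in (0 : ℝ)..x, y t * w t := by
  have hd : ∀ t, HasDerivAt (fun t => y t * deriv w t - deriv y t * w t)
      ((z - z') * (y t * w t)) t := by
    intro t
    refine (((hy.hasDerivAt t).mul (hw.hasDerivAt_deriv t)).sub
      ((hy.hasDerivAt_deriv t).mul (hw.hasDerivAt t))).congr_deriv ?_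
    ring
  have hc : Continuous fun t => (z - z') * (y t * w t) :=
    continuous_const.mul (hy.continuous.mul hw.continuous)
  have h := intervalIntegral.integral_eq_sub_of_hasDerivAt (a := 0) (b := x)
    (fun t _ => hd t) (hc.intervalIntegrable _ _)
  rw [intervalIntegral.integral_const_mul] at h
  rw [h, hy.value_zero, hy.deriv_zero, hw.value_zero, hw.deriv_zero]
  ring

theorem conj (hy : IsSchrodingerIVP V z a b y) :
    IsSchrodingerIVP V (starRingEnd ℂ z) (starRingEnd ℂ a) (starRingEnd ℂ b)
      (fun x => starRingEnd ℂ (y x)) := by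
  refine of_hasDerivAt (y' := fun x => starRingEnd ℂ (deriv y x))
    (fun x => (hy.hasDerivAt x).star) (fun x => ?_) ?_ ?_
  · refine (hy.hasDerivAt_deriv x).star.congr_deriv ?_
    change starRingEnd ℂ _ = _
    simp
  · simp [hy.value_zero]
  · simp [hy.deriv_zero]

theorem comp_neg (hEven : ∀ x, V (-x) = V x) (hy : IsSchrodingerIVP V z a b y) :
    IsSchrodingerIVP V z a (-b) (fun x => y (-x)) := by
  refine of_hasDerivAt (y' := fun x => -deriv y (-x)) (fun x => ?_) (fun x => ?_) ?_ ?_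
  · exact ((hy.hasDerivAt (-x)).scomp x (hasDerivAt_neg x)).congr_deriv (by simp)
  · refine ((hy.hasDerivAt_deriv (-x)).scomp x (hasDerivAt_neg x)).neg.congr_deriv ?_
    rw [hEven]
    simp
  · simp [hy.value_zero]
  · simp [hy.deriv_zero]

theorem const_mul (c : ℂ) (hy : IsSchrodingerIVP V z a b y) :
    IsSchrodingerIVP V z (c * a) (c * b) (fun x => c * y x) := by
  refine of_hasDerivAt (y' := fun x => c * deriv y x)
    (fun x => (hy.hasDerivAt x).const_mul c) (fun x => ?_) ?_ ?_
  · exact ((hy.hasDerivAt_deriv x).const_mul c).congr_deriv (by ring)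
  · simp [hy.value_zero]
  · simp [hy.deriv_zero]

theorem add {a' b' : ℂ} {w : ℝ → ℂ} (hy : IsSchrodingerIVP V z a b y)
    (hw : IsSchrodingerIVP V z a' b' w) :
    IsSchrodingerIVP V z (a + a') (b + b') (fun x => y x + w x) := by
  refine of_hasDerivAt (y' := fun x => deriv y x + deriv w x)
    (fun x => (hy.hasDerivAt x).add (hw.hasDerivAt x)) (fun x => ?_) ?_ ?_
  · exact ((hy.hasDerivAt_deriv x).add (hw.hasDerivAt_deriv x)).congr_deriv (by ring)
  · simp [hy.value_zero, hw.value_zero]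
  · simp [hy.deriv_zero, hw.deriv_zero]

end IsSchrodingerIVP

/-- `u` and `v` solve the equation with spectral parameter `z₀` and initial data `(p, q)`, `(r, s)`
of Wronskian one. -/
structure IsFundamentalPair (V : ℝ → ℝ) (z₀ p q r s : ℂ) (u v : ℝ → ℂ) : Prop where
  left : IsSchrodingerIVP V z₀ p q u
  right : IsSchrodingerIVP V z₀ r s v
  det : p * s - q * r = 1

namespace IsFundamentalPair

variable {V : ℝ → ℝ} {z₀ z p q r s : ℂ} {u v y : ℝ → ℂ}

theorem wronskian (h : IsFundamentalPair V z₀ p q r s u v) (x : ℝ) :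
    u x * deriv v x - deriv u x * v x = 1 := by
  rw [h.left.wronskian_eq h.right x, h.det]
  ring

/-- The Volterra equation for the dependence on the spectral parameter. -/
theorem volterra (h : IsFundamentalPair V z₀ p q r s u v) (hy : IsSchrodingerIVP V z p q y)
    (x : ℝ) :
    y x = u x * (1 + (z - z₀) * ∫ t in (0 : ℝ)..x, v t * y t) -
      v x * ((z - z₀) * ∫ t in (0 : ℝ)..x, u t * y t) := by
  -- The Wronskians of `y` with `u` and with `v` form a linear system for `y x` and `deriv y x`
  -- whose determinant is the Wronskian of `u` and `v`, namely one; Cramer's rule gives the formula.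
  linear_combination (-y x) * h.wronskian x + v x * h.left.wronskian_eq hy x
    - u x * h.right.wronskian_eq hy x + u x * h.det

theorem volterra_deriv (h : IsFundamentalPair V z₀ p q r s u v)
    (hy : IsSchrodingerIVP V z p q y) (x : ℝ) :
    deriv y x = deriv u x * (1 + (z - z₀) * ∫ t in (0 : ℝ)..x, v t * y t) -
      deriv v x * ((z - z₀) * ∫ t in (0 : ℝ)..x, u t * y t) := by
  linear_combination (-deriv y x) * h.wronskian x + deriv v x * h.left.wronskian_eq hy x
    - deriv u x * h.right.wronskian_eq hy x + deriv u x * h.det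

end IsFundamentalPair

theorem norm_integral_zero_le {f : ℝ → ℂ} {B x : ℝ} (hx : 0 ≤ x)
    (hf : ∀ t ∈ Icc 0 x, ‖f t‖ ≤ B) : ‖∫ t in (0 : ℝ)..x, f t‖ ≤ B * x := by
  have h := intervalIntegral.norm_integral_le_of_norm_le_const (a := 0) (b := x) (f := f) (C := B)
    fun t ht => hf t (Ioc_subset_Icc_self (by rwa [uIoc_of_le hx] at ht))
  rwa [sub_zero, abs_of_nonneg hx] at h

/-- On `[0, M]` the first solution decays at rate `lam` and the second grows at most at that
rate. -/
structure HasDichotomy (u v : ℝ → ℂ) (C lam M : ℝ) : Prop where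
  rate_nonneg : 0 ≤ lam
  left : ∀ t ∈ Icc 0 M, ‖u t‖ ≤ C * Real.exp (-lam * t)
  left_deriv : ∀ t ∈ Icc 0 M, ‖deriv u t‖ ≤ C * Real.exp (-lam * t)
  right : ∀ t ∈ Icc 0 M, ‖v t‖ ≤ C * Real.exp (lam * t)
  right_deriv : ∀ t ∈ Icc 0 M, ‖deriv v t‖ ≤ C * Real.exp (lam * t)

namespace HasDichotomy

variable {V : ℝ → ℝ} {z₀ z p q r s : ℂ} {u v y : ℝ → ℂ} {C lam M : ℝ}

theorem const_nonneg (h : HasDichotomy u v C lam M) (hM : 0 ≤ M) : 0 ≤ C := by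
  have := (norm_nonneg _).trans (h.left 0 ⟨le_rfl, hM⟩)
  simpa using this

theorem exp_neg_le (h : HasDichotomy u v C lam M) {t : ℝ} (ht : 0 ≤ t) :
    Real.exp (-lam * t) ≤ Real.exp (lam * t) :=
  Real.exp_le_exp.2 (by nlinarith [mul_nonneg h.rate_nonneg ht])

/-- The combination occurring in the Volterra equation, for a function of growth rate `lam`. -/
theorem kernel_bound (h : HasDichotomy u v C lam M) {G : ℝ} {A B ζ : ℂ} {x : ℝ}
    (hx : x ∈ Icc 0 M) (hG : 0 ≤ G) (hy : ∀ t ∈ Icc 0 x, ‖y t‖ ≤ G * Real.exp (lam * t))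
    (hA : ‖A‖ ≤ C * Real.exp (-lam * x)) (hB : ‖B‖ ≤ C * Real.exp (lam * x)) :
    ‖A * (ζ * ∫ t in (0 : ℝ)..x, v t * y t) - B * (ζ * ∫ t in (0 : ℝ)..x, u t * y t)‖ ≤
      2 * C ^ 2 * ‖ζ‖ * M * G * Real.exp (lam * x) := by
  have hC := h.const_nonneg (hx.1.trans hx.2)
  have hx0 := hx.1
  have hlam := h.rate_nonneg
  -- The integral against `v` may reach `exp (2 lam x)`, but its factor `A` decays like `exp (-lam
  -- x)`. In the integral against `u` the exponentials cancel, leaving linear growth against `B`.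
  -- Each term costs only a factor of `M`.
  have h1 : ‖∫ t in (0 : ℝ)..x, v t * y t‖ ≤
      (C * Real.exp (lam * x) * (G * Real.exp (lam * x))) * x := by
    refine norm_integral_zero_le hx0 fun t ht => ?_
    rw [norm_mul]
    have he : Real.exp (lam * t) ≤ Real.exp (lam * x) :=
      Real.exp_le_exp.2 (mul_le_mul_of_nonneg_left ht.2 hlam)
    exact mul_le_mul ((h.right t ⟨ht.1, ht.2.trans hx.2⟩).trans (by gcongr))
      ((hy t ht).trans (by gcongr)) (norm_nonneg _) (by positivity)
  have h2 : ‖∫ t in (0 : ℝ)..x, u t * y t‖ ≤ (C * G) * x := by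
    refine norm_integral_zero_le hx0 fun t ht => ?_
    rw [norm_mul]
    calc _ ≤ (C * Real.exp (-lam * t)) * (G * Real.exp (lam * t)) :=
          mul_le_mul (h.left t ⟨ht.1, ht.2.trans hx.2⟩) (hy t ht) (norm_nonneg _) (by positivity)
      _ = C * G * Real.exp (-lam * t + lam * t) := by rw [Real.exp_add]; ring
      _ = C * G := by simp
  have e : Real.exp (-lam * x) * Real.exp (lam * x) = 1 := by rw [← Real.exp_add]; simp
  refine (norm_sub_le _ _).trans ?_
  rw [norm_mul, norm_mul, norm_mul, norm_mul]
  calc _ ≤ (C * Real.exp (-lam * x)) *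
        (‖ζ‖ * ((C * Real.exp (lam * x) * (G * Real.exp (lam * x))) * M)) +
        (C * Real.exp (lam * x)) * (‖ζ‖ * (C * G * M)) := by
        have h3 := h1.trans (mul_le_mul_of_nonneg_left hx.2 (by positivity))
        have h4 := h2.trans (mul_le_mul_of_nonneg_left hx.2 (by positivity))
        gcongr
    _ = _ := by linear_combination (C ^ 2 * ‖ζ‖ * M * G * Real.exp (lam * x)) * e

/-- An absorption argument: the maximum `G` of `‖y x‖ exp (-lam x)` is finite by compactness, and
the Volterra equation yields `G ≤ C + G / 2`. The rate `lam` is therefore preserved exactly,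
provided `z - z₀` is at most of order `1 / M`. -/
theorem norm_le (h : HasDichotomy u v C lam M) (hF : IsFundamentalPair V z₀ p q r s u v)
    (hM : 0 ≤ M) (hy : IsSchrodingerIVP V z p q y) (hz : 4 * C ^ 2 * M * ‖z - z₀‖ ≤ 1) :
    ∀ x ∈ Icc 0 M, ‖y x‖ ≤ 2 * C * Real.exp (lam * x) ∧
      ‖deriv y x‖ ≤ 2 * C * Real.exp (lam * x) := by
  have hC := h.const_nonneg hM
  have hcont : ContinuousOn (fun x => ‖y x‖ * Real.exp (-lam * x)) (Icc 0 M) := by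
    have := hy.continuous
    fun_prop
  obtain ⟨x₀, hx₀, hmax⟩ := isCompact_Icc.exists_isMaxOn ⟨0, le_rfl, hM⟩ hcont
  obtain ⟨G, hGdef⟩ : ∃ G, G = ‖y x₀‖ * Real.exp (-lam * x₀) := ⟨_, rfl⟩
  have hG0 : 0 ≤ G := by rw [hGdef]; positivity
  have e : ∀ x, Real.exp (-lam * x) * Real.exp (lam * x) = 1 := fun x => by
    rw [← Real.exp_add]; simp
  have hyG : ∀ t ∈ Icc 0 M, ‖y t‖ ≤ G * Real.exp (lam * t) := by
    intro t ht
    have h1 : ‖y t‖ * Real.exp (-lam * t) ≤ G := hGdef ▸ hmax ht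
    calc ‖y t‖ = ‖y t‖ * Real.exp (-lam * t) * Real.exp (lam * t) := by
          rw [mul_assoc, e, mul_one]
      _ ≤ _ := by gcongr
  have key : ∀ x ∈ Icc 0 M, ∀ A B Y : ℂ, ‖A‖ ≤ C * Real.exp (-lam * x) →
      ‖B‖ ≤ C * Real.exp (lam * x) →
      Y = A * (1 + (z - z₀) * ∫ t in (0 : ℝ)..x, v t * y t) -
        B * ((z - z₀) * ∫ t in (0 : ℝ)..x, u t * y t) →
      ‖Y‖ ≤ C * Real.exp (-lam * x) + G / 2 * Real.exp (lam * x) := by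
    intro x hx A B Y hA hB hY
    have h1 := h.kernel_bound (ζ := z - z₀) hx hG0
      (fun t ht => hyG t ⟨ht.1, ht.2.trans hx.2⟩) hA hB
    have h2 : Y = A + (A * ((z - z₀) * ∫ t in (0 : ℝ)..x, v t * y t) -
        B * ((z - z₀) * ∫ t in (0 : ℝ)..x, u t * y t)) := by rw [hY]; ring
    rw [h2]
    refine (norm_add_le _ _).trans (add_le_add hA (h1.trans ?_))
    have h3 : 0 ≤ G * Real.exp (lam * x) := by positivity
    nlinarith
  have hG : G ≤ 2 * C := by
    have h1 := key x₀ hx₀ _ _ _ (h.left x₀ hx₀) (h.right x₀ hx₀) (hF.volterra hy x₀)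
    have h2 : G ≤ (C * Real.exp (-lam * x₀) + G / 2 * Real.exp (lam * x₀)) *
        Real.exp (-lam * x₀) := by
      rw [hGdef] at h1 ⊢; gcongr
    have h3 : Real.exp (-lam * x₀) ≤ 1 :=
      Real.exp_le_one_iff.2 (by nlinarith [mul_nonneg h.rate_nonneg hx₀.1])
    have h4 := Real.exp_pos (-lam * x₀)
    have h5 : C * Real.exp (-lam * x₀) * Real.exp (-lam * x₀) ≤ C := by
      calc _ ≤ C * 1 * 1 := by gcongr
        _ = C := by ring
    have h6 := e x₀
    nlinarith
  intro x hx
  refine ⟨(hyG x hx).trans (by gcongr), ?_⟩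
  refine (key x hx _ _ _ (h.left_deriv x hx) (h.right_deriv x hx) (hF.volterra_deriv hy x)).trans ?_
  have h1 := h.exp_neg_le hx.1
  have h2 := Real.exp_pos (lam * x)
  nlinarith

end HasDichotomy

/-- With rate zero a dichotomy is mere boundedness on a compact interval. This suffices for
differentiability in `z` at a fixed endpoint, where constants may depend on the interval. -/
theorem exists_hasDichotomy_zero {V : ℝ → ℝ} {z₀ p q r s : ℂ} {u v : ℝ → ℂ}
    (hF : IsFundamentalPair V z₀ p q r s u v) (M : ℝ) : ∃ C, HasDichotomy u v C 0 M := by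
  have hb : ∀ f : ℝ → ℂ, Continuous f → ∃ C, ∀ t ∈ Icc 0 M, ‖f t‖ ≤ C := fun f hf =>
    isCompact_Icc.exists_bound_of_continuousOn hf.continuousOn
  obtain ⟨C₁, h₁⟩ := hb _ hF.left.continuous
  obtain ⟨C₂, h₂⟩ := hb _ hF.left.continuous_deriv
  obtain ⟨C₃, h₃⟩ := hb _ hF.right.continuous
  obtain ⟨C₄, h₄⟩ := hb _ hF.right.continuous_deriv
  refine ⟨max (max C₁ C₂) (max C₃ C₄), le_rfl, ?_, ?_, ?_, ?_⟩ <;> intro t ht <;>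
    simp only [neg_zero, zero_mul, Real.exp_zero, mul_one, le_max_iff]
  · exact .inl (.inl (h₁ t ht))
  · exact .inl (.inr (h₂ t ht))
  · exact .inr (.inl (h₃ t ht))
  · exact .inr (.inr (h₄ t ht))

theorem hasDerivAt_of_sq_bound {f : ℂ → ℂ} {z₀ d : ℂ} {K : ℝ}
    (h : ∀ᶠ z in 𝓝 z₀, ‖f z - f z₀ - (z - z₀) * d‖ ≤ K * ‖z - z₀‖ ^ 2) : HasDerivAt f d z₀ := by
  rw [hasDerivAt_iff_isLittleO]
  have h1 : (fun z => f z - f z₀ - (z - z₀) • d) =O[𝓝 z₀] fun z => ‖z - z₀‖ ^ 2 := by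
    refine Asymptotics.IsBigO.of_bound K (h.mono fun z hz => ?_)
    simpa using hz
  refine h1.trans_isLittleO ?_
  have h2 : (fun w : ℂ => ‖w‖ ^ 2) =o[𝓝 0] fun w : ℂ => w :=
    Asymptotics.isLittleO_norm_pow_id one_lt_two
  have h3 : Tendsto (fun z => z - z₀) (𝓝 z₀) (𝓝 0) := by
    have : Continuous fun z : ℂ => z - z₀ := by fun_prop
    simpa using this.tendsto z₀
  exact h2.comp_tendsto h3

/-- Differentiability in the spectral parameter, with the derivative given by variation of
constants. -/
theorem IsFundamentalPair.hasDerivAt_param {V : ℝ → ℝ} {z₀ p q r s : ℂ} {v : ℝ → ℂ}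
    {y : ℂ → ℝ → ℂ} (hy : ∀ z, IsSchrodingerIVP V z p q (y z))
    (hF : IsFundamentalPair V z₀ p q r s (y z₀) v) {x : ℝ} (hx : 0 ≤ x) :
    HasDerivAt (fun z => y z x) (y z₀ x * (∫ t in (0 : ℝ)..x, v t * y z₀ t) -
      v x * ∫ t in (0 : ℝ)..x, y z₀ t * y z₀ t) z₀ ∧
    HasDerivAt (fun z => deriv (y z) x) (deriv (y z₀) x * (∫ t in (0 : ℝ)..x, v t * y z₀ t) -
      deriv v x * ∫ t in (0 : ℝ)..x, y z₀ t * y z₀ t) z₀ := by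
  obtain ⟨C, hD⟩ := exists_hasDichotomy_zero hF x
  have hC := hD.const_nonneg hx
  have hev : ∀ᶠ z in 𝓝 z₀, 4 * C ^ 2 * x * ‖z - z₀‖ ≤ 1 := by
    have h1 : Continuous fun z : ℂ => 4 * C ^ 2 * x * ‖z - z₀‖ := by fun_prop
    have h2 := h1.tendsto z₀
    simp only [sub_self, norm_zero, mul_zero] at h2
    exact h2.eventually_le_const zero_lt_one
  have hbd : ∀ z, 4 * C ^ 2 * x * ‖z - z₀‖ ≤ 1 → ∀ t ∈ Icc 0 x, ‖y z t‖ ≤ 2 * C := by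
    intro z hz t ht
    simpa using (hD.norm_le hF hx (hy z) hz t ht).1
  have hdiff : ∀ z, 4 * C ^ 2 * x * ‖z - z₀‖ ≤ 1 → ∀ t ∈ Icc 0 x,
      ‖y z t - y z₀ t‖ ≤ 4 * C ^ 3 * x * ‖z - z₀‖ := by
    intro z hz t ht
    have h1 := hD.kernel_bound (y := y z) (G := 2 * C) (ζ := z - z₀) ht
      (by positivity) (fun t' ht' => by simpa using hbd z hz t' ⟨ht'.1, ht'.2.trans ht.2⟩)
      (hD.left t ht) (hD.right t ht)
    have h2 := hF.volterra (hy z) t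
    have h3 : y z t - y z₀ t = y z₀ t * ((z - z₀) * ∫ t in (0 : ℝ)..t, v t * y z t) -
        v t * ((z - z₀) * ∫ t in (0 : ℝ)..t, y z₀ t * y z t) := by
      linear_combination h2
    rw [h3]
    refine h1.trans (le_of_eq ?_)
    simp
    ring
  -- Replacing `y z` by `y z₀` inside the Volterra integrals gives the candidate derivative. By
  -- `hdiff` the replacement costs one factor of `z - z₀`, and the prefactor supplies another, so
  -- the remainder is quadratic. `A` and `B` stand for the values or the derivatives of `y z₀` and
  -- `v`.
  have key : ∀ (A B : ℂ) (Y : ℂ → ℂ), ‖A‖ ≤ C → ‖B‖ ≤ C →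
      (∀ z, Y z = A * (1 + (z - z₀) * ∫ t in (0 : ℝ)..x, v t * y z t) -
        B * ((z - z₀) * ∫ t in (0 : ℝ)..x, y z₀ t * y z t)) →
      HasDerivAt Y (A * (∫ t in (0 : ℝ)..x, v t * y z₀ t) -
        B * ∫ t in (0 : ℝ)..x, y z₀ t * y z₀ t) z₀ := by
    intro A B Y hA hB hY
    refine hasDerivAt_of_sq_bound (K := 2 * C ^ 2 * x * (4 * C ^ 3 * x)) ?_
    filter_upwards [hev] with z hz
    have hint : ∀ (f : ℝ → ℂ), Continuous f → (∫ t in (0 : ℝ)..x, f t * (y z t - y z₀ t)) =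
        (∫ t in (0 : ℝ)..x, f t * y z t) - ∫ t in (0 : ℝ)..x, f t * y z₀ t := by
      intro f hf
      have h1 : Continuous fun t => f t * y z t := hf.mul (hy z).continuous
      have h2 : Continuous fun t => f t * y z₀ t := hf.mul (hy z₀).continuous
      simp only [mul_sub]
      exact intervalIntegral.integral_sub (h1.intervalIntegrable _ _) (h2.intervalIntegrable _ _)
    have h1 := hD.kernel_bound (y := fun t => y z t - y z₀ t) (G := 4 * C ^ 3 * x * ‖z - z₀‖)
      (A := A) (B := B) (ζ := z - z₀) (x := x) ⟨hx, le_rfl⟩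
      (by positivity) (fun t ht => by simpa using hdiff z hz t ht)
      (by simpa using hA) (by simpa using hB)
    rw [hint _ hF.right.continuous, hint _ hF.left.continuous] at h1
    have h2 : Y z - Y z₀ - (z - z₀) * (A * (∫ t in (0 : ℝ)..x, v t * y z₀ t) -
        B * ∫ t in (0 : ℝ)..x, y z₀ t * y z₀ t) =
        A * ((z - z₀) * ((∫ t in (0 : ℝ)..x, v t * y z t) - ∫ t in (0 : ℝ)..x, v t * y z₀ t)) -
        B * ((z - z₀) * ((∫ t in (0 : ℝ)..x, y z₀ t * y z t) -
          ∫ t in (0 : ℝ)..x, y z₀ t * y z₀ t)) := by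
      rw [hY z, hY z₀]; ring
    rw [h2]
    refine h1.trans (le_of_eq ?_)
    simp
    ring
  have hxx : x ∈ Icc 0 x := ⟨hx, le_rfl⟩
  exact ⟨key _ _ _ (by simpa using hD.left x hxx) (by simpa using hD.right x hxx)
      fun z => hF.volterra (hy z) x,
    key _ _ _ (by simpa using hD.left_deriv x hxx) (by simpa using hD.right_deriv x hxx)
      fun z => hF.volterra_deriv (hy z) x⟩

end SchrodingerODE

/-! ### Decay of square integrable solutions and the Floquet dichotomy. -/

section Floquet

open Set Filter Topology MeasureTheory

theorem IsDefectPotential.eventually_periodic {V : ℝ → ℝ} {ρ : ℝ} (hV : IsDefectPotential V ρ)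
    {x : ℝ} (hx : ρ < x) : V (x + 1) = V x := by
  obtain ⟨Vper, Vdef, h, hper, hdef⟩ := hV.decomposition
  have hρ := hV.radius_nonneg
  rw [h, h, hper, hdef x (by rwa [abs_of_nonneg (by linarith)]),
    hdef (x + 1) (by rw [abs_of_nonneg (by linarith)]; linarith)]

theorem exists_bound_of_eventually_periodic {h : ℝ → ℝ} (hc : Continuous h) {R : ℝ}
    (hper : ∀ x, R ≤ x → h (x + 1) = h x) : ∃ C, 0 ≤ C ∧ ∀ x, 0 ≤ x → |h x| ≤ C := by
  obtain ⟨C, hC⟩ := isCompact_Icc.exists_bound_of_continuousOn (s := Icc (-|R|) (|R| + 1))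
    hc.continuousOn
  have hR := abs_nonneg R
  have key : ∀ n : ℕ, ∀ x, 0 ≤ x → x ≤ |R| + 1 + n → |h x| ≤ C := by
    intro n
    induction n with
    | zero => exact fun x hx hx' => hC x ⟨by linarith, by simpa using hx'⟩
    | succ n ih =>
      intro x hx hx'
      push_cast at hx'
      by_cases hle : x ≤ |R| + 1
      · exact ih x hx (by linarith [(Nat.cast_nonneg n : (0 : ℝ) ≤ n)])
      · push Not at hle
        have h1 := hper (x - 1) (by linarith [le_abs_self R])
        rw [sub_add_cancel] at h1
        rw [h1]
        exact ih _ (by linarith) (by linarith)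
  refine ⟨C, (norm_nonneg _).trans (hC 0 ⟨by linarith, by linarith⟩), fun x hx => ?_⟩
  obtain ⟨n, hn⟩ := exists_nat_ge x
  exact key n x hx (by linarith)

/-- Dividing `‖f x‖` by `exp (l x)` leaves a continuous, eventually periodic function, which is
bounded on the half-line. -/
theorem exists_exp_bound_of_multiplier {f : ℝ → ℂ} (hf : Continuous f) {R l : ℝ} {q : ℂ}
    (hq : ‖q‖ = Real.exp l) (hper : ∀ x, R ≤ x → f (x + 1) = q * f x) :
    ∃ C, 0 ≤ C ∧ ∀ x, 0 ≤ x → ‖f x‖ ≤ C * Real.exp (l * x) := by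
  obtain ⟨C, hC0, hC⟩ := exists_bound_of_eventually_periodic
    (h := fun x => ‖f x‖ * Real.exp (-(l * x))) (by fun_prop) (R := R) (fun x hx => by
      have e : Real.exp (-(l * (x + 1))) = Real.exp (-(l * x)) * Real.exp (-l) := by
        rw [← Real.exp_add]; ring_nf
      have e2 : Real.exp l * Real.exp (-l) = 1 := by rw [← Real.exp_add]; simp
      rw [hper x hx, norm_mul, hq, e]
      linear_combination ‖f x‖ * Real.exp (-(l * x)) * e2)
  refine ⟨C, hC0, fun x hx => ?_⟩
  have h1 := (le_abs_self _).trans (hC x hx)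
  calc ‖f x‖ = ‖f x‖ * Real.exp (-(l * x)) * Real.exp (l * x) := by
        rw [mul_assoc, ← Real.exp_add]; simp
    _ ≤ _ := by gcongr

/-- Cauchy-Schwarz on a unit interval, in the form that the variance of `‖y‖` is nonnegative. -/
theorem sq_integral_norm_le {y : ℝ → ℂ} (hy : Continuous y) (x : ℝ) :
    (∫ t in x..x + 1, ‖y t‖) ^ 2 ≤ ∫ t in x..x + 1, ‖y t‖ ^ 2 := by
  obtain ⟨m, hm⟩ : ∃ m, m = ∫ t in x..x + 1, ‖y t‖ := ⟨_, rfl⟩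
  have h0 : 0 ≤ ∫ t in x..x + 1, (‖y t‖ - m) ^ 2 :=
    intervalIntegral.integral_nonneg (by linarith) fun t _ => sq_nonneg _
  have c1 : Continuous fun t => ‖y t‖ ^ 2 := by fun_prop
  have c2 : Continuous fun t => 2 * m * ‖y t‖ := by fun_prop
  have h1 : ∫ t in x..x + 1, (‖y t‖ - m) ^ 2 =
      (∫ t in x..x + 1, ‖y t‖ ^ 2) - 2 * m * m + m ^ 2 := by
    have h2 : ∀ t, (‖y t‖ - m) ^ 2 = ‖y t‖ ^ 2 - 2 * m * ‖y t‖ + m ^ 2 := fun t => by ring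
    simp only [h2]
    have c3 : Continuous fun t => ‖y t‖ ^ 2 - 2 * m * ‖y t‖ := c1.sub c2
    rw [intervalIntegral.integral_add (c3.intervalIntegrable _ _)
      (continuous_const.intervalIntegrable _ _),
      intervalIntegral.integral_sub (c1.intervalIntegrable _ _) (c2.intervalIntegrable _ _),
      intervalIntegral.integral_const_mul, ← hm]
    simp
  rw [← hm]
  nlinarith

theorem tendsto_integral_norm_unit_zero {y : ℝ → ℂ} (hy : Continuous y) (hL : MemLp y 2 volume) :
    Tendsto (fun x : ℝ => ∫ t in x..x + 1, ‖y t‖) atTop (𝓝 0) := by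
  have hint : Integrable (fun t => ‖y t‖ ^ 2) := (memLp_two_iff_integrable_sq_norm hL.1).1 hL
  have h1 := intervalIntegral_tendsto_integral_Ioi 0 hint.integrableOn tendsto_id
  have h2 := h1.comp (tendsto_atTop_add_const_right atTop (1 : ℝ) tendsto_id)
  have h3 := h2.sub h1
  have h4 : Tendsto (fun x : ℝ => ∫ t in x..x + 1, ‖y t‖ ^ 2) atTop (𝓝 0) := by
    rw [sub_self] at h3
    refine h3.congr fun x => ?_
    have c1 : Continuous fun t => ‖y t‖ ^ 2 := by fun_prop
    exact intervalIntegral.integral_interval_sub_left (c1.intervalIntegrable _ _)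
      (c1.intervalIntegrable _ _)
  have h5 := h4.sqrt
  rw [Real.sqrt_zero] at h5
  refine squeeze_zero (fun x => intervalIntegral.integral_nonneg (by linarith)
    fun t _ => norm_nonneg _) (fun x => ?_) h5
  exact Real.le_sqrt_of_sq_le (sq_integral_norm_le hy x)

/-- Testing the equation on `[x, x + 1]` against a cubic that vanishes doubly at `x + 1`. -/
theorem IsSchrodingerIVP.norm_le_integral {V : ℝ → ℝ} (hVc : Continuous V) {z a b : ℂ}
    {y : ℝ → ℂ} (hy : IsSchrodingerIVP V z a b y) {K : ℝ}
    (hK : ∀ t, 0 ≤ t → ‖(V t : ℂ) - z‖ ≤ K) (c₀ c₁ c₂ c₃ : ℝ) (h0 : c₀ + c₁ + c₂ + c₃ = 0)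
    (h1 : c₁ + 2 * c₂ + 3 * c₃ = 0) {x : ℝ} (hx : 0 ≤ x) :
    ‖c₀ * deriv y x - c₁ * y x‖ ≤
      ((|c₀| + |c₁| + |c₂| + |c₃|) * K + 2 * |c₂| + 6 * |c₃|) * ∫ t in x..x + 1, ‖y t‖ := by
  -- For the cubic `P`, `(P y' - P' y)' = (P (V - z) - P'') y` contains no derivative of `y`. The
  -- double zero of `P` removes the boundary term at `x + 1`, and at `x` it is `c₀ y' - c₁ y`.
  have hd : ∀ t : ℝ, HasDerivAt (fun t : ℝ =>
      (c₀ + c₁ * (t - x) + c₂ * (t - x) ^ 2 + c₃ * (t - x) ^ 3 : ℂ) * deriv y t -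
        (c₁ + 2 * c₂ * (t - x) + 3 * c₃ * (t - x) ^ 2 : ℂ) * y t)
      (((c₀ + c₁ * (t - x) + c₂ * (t - x) ^ 2 + c₃ * (t - x) ^ 3 : ℂ) * (V t - z) -
        (2 * c₂ + 6 * c₃ * (t - x) : ℂ)) * y t) t := by
    intro t
    have hs : HasDerivAt (fun t : ℝ => ((t : ℂ) - x)) 1 t :=
      (Complex.ofRealCLM.hasDerivAt (x := t)).sub_const _
    have hp := (((hs.const_mul (c₁ : ℂ)).const_add (c₀ : ℂ)).add
      ((hs.pow 2).const_mul (c₂ : ℂ))).add ((hs.pow 3).const_mul (c₃ : ℂ))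
    have hp' := ((hs.const_mul (2 * c₂ : ℂ)).const_add (c₁ : ℂ)).add
      ((hs.pow 2).const_mul (3 * c₃ : ℂ))
    refine ((hp.mul (hy.hasDerivAt_deriv t)).sub (hp'.mul (hy.hasDerivAt t))).congr_deriv ?_
    simp
    ring
  have hcont : Continuous fun t : ℝ =>
      (((c₀ + c₁ * (t - x) + c₂ * (t - x) ^ 2 + c₃ * (t - x) ^ 3 : ℂ) * (V t - z) -
        (2 * c₂ + 6 * c₃ * (t - x) : ℂ)) * y t) := by
    have := hy.continuous
    fun_prop
  have h2 := intervalIntegral.integral_eq_sub_of_hasDerivAt (a := x) (b := x + 1)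
    (fun t _ => hd t) (hcont.intervalIntegrable _ _)
  have h0' : (c₀ + c₁ + c₂ + c₃ : ℂ) = 0 := by exact_mod_cast h0
  have h1' : (c₁ + 2 * c₂ + 3 * c₃ : ℂ) = 0 := by exact_mod_cast h1
  have h3 : c₀ * deriv y x - c₁ * y x = -∫ t in x..x + 1,
      (((c₀ + c₁ * (t - x) + c₂ * (t - x) ^ 2 + c₃ * (t - x) ^ 3 : ℂ) * (V t - z) -
        (2 * c₂ + 6 * c₃ * (t - x) : ℂ)) * y t) := by
    rw [h2]
    push_cast
    linear_combination deriv y (x + 1) * h0' - y (x + 1) * h1'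
  rw [h3, norm_neg, ← intervalIntegral.integral_const_mul]
  have hyc := hy.continuous
  refine intervalIntegral.norm_integral_le_of_norm_le (by linarith)
    (ae_of_all _ fun t ht => ?_) (Continuous.intervalIntegrable (by fun_prop) _ _)
  rw [norm_mul]
  refine mul_le_mul_of_nonneg_right ?_ (norm_nonneg _)
  have hs0 : 0 ≤ t - x := by linarith [ht.1]
  have hs1 : t - x ≤ 1 := by linarith [ht.2]
  have hsn : ‖((t : ℂ) - x)‖ ≤ 1 := by
    rw [← Complex.ofReal_sub, Complex.norm_real, Real.norm_of_nonneg hs0]; exact hs1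
  have hsp : ∀ n : ℕ, ‖((t : ℂ) - x) ^ n‖ ≤ 1 := fun n => by
    rw [norm_pow]; exact pow_le_one₀ (norm_nonneg _) hsn
  have hm : ∀ (c : ℝ) (w : ℂ), ‖w‖ ≤ 1 → ‖(c : ℂ) * w‖ ≤ |c| := fun c w hw => by
    rw [norm_mul, Complex.norm_real, Real.norm_eq_abs]
    exact mul_le_of_le_one_right (abs_nonneg c) hw
  have hc0 : ‖(c₀ : ℂ)‖ = |c₀| := by rw [Complex.norm_real, Real.norm_eq_abs]
  have hP : ‖(c₀ + c₁ * (t - x) + c₂ * (t - x) ^ 2 + c₃ * (t - x) ^ 3 : ℂ)‖ ≤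
      |c₀| + |c₁| + |c₂| + |c₃| :=
    norm_add_le_of_le (norm_add_le_of_le (norm_add_le_of_le hc0.le (hm _ _ hsn)) (hm _ _ (hsp 2)))
      (hm _ _ (hsp 3))
  have hQ : ‖(2 * c₂ + 6 * c₃ * (t - x) : ℂ)‖ ≤ 2 * |c₂| + 6 * |c₃| := by
    refine norm_add_le_of_le ?_ ?_
    · simp
    · rw [mul_assoc, norm_mul]
      simpa using hm c₃ _ hsn
  have := (norm_sub_le _ _).trans (add_le_add ((norm_mul_le _ _).trans
    (mul_le_mul hP (hK t (by linarith)) (norm_nonneg _) (by positivity))) hQ)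
  linarith

/-- Square integrability makes the integrals over `[x, x + 1]` small; the equation upgrades this to
pointwise decay. In `s = t - x`, the cubic `-s (1 - s)²` isolates `y x` and `1 - 3 s² + 2 s³`
isolates `deriv y x`. -/
theorem IsSchrodingerIVP.tendsto_zero_of_memLp {V : ℝ → ℝ} (hVc : Continuous V) {z a b : ℂ}
    {y : ℝ → ℂ} (hy : IsSchrodingerIVP V z a b y) {K : ℝ}
    (hK : ∀ t, 0 ≤ t → ‖(V t : ℂ) - z‖ ≤ K) (hL : MemLp y 2 volume) :
    Tendsto y atTop (𝓝 0) ∧ Tendsto (deriv y) atTop (𝓝 0) := by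
  have h := tendsto_integral_norm_unit_zero hy.continuous hL
  constructor
  · have h1 := h.const_mul ((|(0 : ℝ)| + |-1| + |2| + |-1|) * K + 2 * |2| + 6 * |-1|)
    rw [mul_zero] at h1
    refine squeeze_zero_norm' ((eventually_ge_atTop 0).mono fun x hx => ?_) h1
    have := hy.norm_le_integral hVc hK 0 (-1) 2 (-1) (by norm_num) (by norm_num) hx
    simpa using this
  · have h1 := h.const_mul ((|(1 : ℝ)| + |0| + |-3| + |2|) * K + 2 * |-3| + 6 * |2|)
    rw [mul_zero] at h1
    refine squeeze_zero_norm' ((eventually_ge_atTop 0).mono fun x hx => ?_) h1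
    have := hy.norm_le_integral hVc hK 1 0 (-3) 2 (by norm_num) (by norm_num) hx
    simpa using this

/-- This half-line version is needed for the translate `y (x + 1)`, which solves the equation only
where the potential is already periodic. -/
theorem wronskian_eq_of_hasDerivAt {f f' g g' P : ℝ → ℂ} {R : ℝ}
    (hf : ∀ x, R ≤ x → HasDerivAt f (f' x) x) (hf' : ∀ x, R ≤ x → HasDerivAt f' (P x * f x) x)
    (hg : ∀ x, R ≤ x → HasDerivAt g (g' x) x) (hg' : ∀ x, R ≤ x → HasDerivAt g' (P x * g x) x)
    {x : ℝ} (hx : R ≤ x) : f x * g' x - f' x * g x = f R * g' R - f' R * g R := by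
  have hd : ∀ t, R ≤ t → HasDerivAt (fun t => f t * g' t - f' t * g t) 0 t := fun t ht =>
    (((hf t ht).mul (hg' t ht)).sub ((hf' t ht).mul (hg t ht))).congr_deriv (by ring)
  exact constant_of_has_deriv_right_zero (a := R) (b := x)
    (f := fun t => f t * g' t - f' t * g t)
    (fun t ht => (hd t ht.1).continuousAt.continuousWithinAt)
    (fun t ht => (hd t ht.1).hasDerivWithinAt) x ⟨hx, le_rfl⟩

/-- If the first solution of a fundamental pair is square integrable and the potential is
eventually periodic, the pair has an exponential dichotomy on `[0, ∞)`. -/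
theorem IsFundamentalPair.exists_hasDichotomy {V : ℝ → ℝ} {ρ : ℝ} (hV : IsDefectPotential V ρ)
    {z p q r s : ℂ} {u v : ℝ → ℂ} (hF : IsFundamentalPair V z p q r s u v)
    (hL : MemLp u 2 volume) : ∃ lam C : ℝ, 0 < lam ∧ ∀ M, HasDichotomy u v C lam M := by
  have hVc : Continuous V := hV.smooth.continuous
  obtain ⟨R, hR⟩ : ∃ R, R = ρ + 1 := ⟨_, rfl⟩
  have hVper : ∀ x, R ≤ x → V (x + 1) = V x := fun x hx =>
    hV.eventually_periodic (by linarith)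
  obtain ⟨K, -, hK⟩ := exists_bound_of_eventually_periodic hVc hVper
  obtain ⟨tu, tu'⟩ := hF.left.tendsto_zero_of_memLp hVc (K := K + ‖z‖)
    (fun t ht => (norm_sub_le _ _).trans
      (add_le_add (by rw [Complex.norm_real]; exact hK t ht) le_rfl)) hL
  have shift : ∀ {a b : ℂ} {y : ℝ → ℂ}, IsSchrodingerIVP V z a b y →
      (∀ x, R ≤ x → HasDerivAt (fun x => y (x + 1)) (deriv y (x + 1)) x) ∧
      ∀ x, R ≤ x → HasDerivAt (fun x => deriv y (x + 1))
        (((V x : ℂ) - z) * y (x + 1)) x := by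
    intro a b y hy
    refine ⟨fun x _ => (hy.hasDerivAt (x + 1)).comp_add_const x 1, fun x hx => ?_⟩
    have h := (hy.hasDerivAt_deriv (x + 1)).comp_add_const x 1
    rwa [hVper x hx] at h
  have plain : ∀ {a b : ℂ} {y : ℝ → ℂ}, IsSchrodingerIVP V z a b y →
      (∀ x, R ≤ x → HasDerivAt y (deriv y x) x) ∧
      ∀ x, R ≤ x → HasDerivAt (deriv y) (((V x : ℂ) - z) * y x) x :=
    fun hy => ⟨fun x _ => hy.hasDerivAt x, fun x _ => hy.hasDerivAt_deriv x⟩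
  have shifted : Tendsto (fun x : ℝ => x + 1) atTop atTop :=
    tendsto_atTop_add_const_right _ _ tendsto_id
  -- The Wronskian of `u` and its translate is constant and tends to zero, so the two are
  -- proportional on `[R, ∞)`; the factor is the Floquet multiplier `μ`.
  have W0 : ∀ x, R ≤ x → u x * deriv u (x + 1) - deriv u x * u (x + 1) = 0 := by
    have hconst := fun x (hx : R ≤ x) => wronskian_eq_of_hasDerivAt (plain hF.left).1
      (plain hF.left).2 (shift hF.left).1 (shift hF.left).2 hx
    have ht : Tendsto (fun x => u x * deriv u (x + 1) - deriv u x * u (x + 1)) atTop (𝓝 0) := by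
      simpa using (tu.mul (tu'.comp shifted)).sub (tu'.mul (tu.comp shifted))
    have ht2 := ht.congr' ((eventually_ge_atTop R).mono hconst)
    intro x hx
    rw [hconst x hx]
    exact tendsto_nhds_unique tendsto_const_nhds ht2
  obtain ⟨μ, hμ⟩ : ∃ μ, μ = u (R + 1) * deriv v R - deriv u (R + 1) * v R := ⟨_, rfl⟩
  obtain ⟨ν, hν⟩ : ∃ ν, ν = v (R + 1) * deriv v R - deriv v (R + 1) * v R := ⟨_, rfl⟩
  have Wμ : ∀ x, R ≤ x → u (x + 1) * deriv v x - deriv u (x + 1) * v x = μ := fun x hx => by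
    rw [hμ]
    exact wronskian_eq_of_hasDerivAt (shift hF.left).1 (shift hF.left).2
      (plain hF.right).1 (plain hF.right).2 hx
  have Wν : ∀ x, R ≤ x → v (x + 1) * deriv v x - deriv v (x + 1) * v x = ν := fun x hx => by
    rw [hν]
    exact wronskian_eq_of_hasDerivAt (shift hF.right).1 (shift hF.right).2
      (plain hF.right).1 (plain hF.right).2 hx
  have u1 : ∀ x, R ≤ x → u (x + 1) = μ * u x := fun x hx => by
    linear_combination u x * Wμ x hx + v x * W0 x hx - u (x + 1) * hF.wronskian x
  have u1' : ∀ x, R ≤ x → deriv u (x + 1) = μ * deriv u x := fun x hx => by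
    linear_combination deriv u x * Wμ x hx + deriv v x * W0 x hx
      - deriv u (x + 1) * hF.wronskian x
  have hμ0 : μ ≠ 0 := by
    intro h0
    have h1 := hF.wronskian (R + 1)
    rw [u1 R le_rfl, u1' R le_rfl, h0] at h1
    simp at h1
  have hpow : ∀ n : ℕ, u (R + n) = μ ^ n * u R ∧ deriv u (R + n) = μ ^ n * deriv u R := by
    intro n
    induction n with
    | zero => simp
    | succ n ih =>
      have hn : R ≤ R + n := by linarith [(Nat.cast_nonneg n : (0 : ℝ) ≤ n)]
      push_cast
      rw [← add_assoc, u1 _ hn, u1' _ hn, ih.1, ih.2]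
      constructor <;> ring
  -- The Wronskian of `u (· + n)` with `v`, taken at `R`, equals `μ ^ n`; it tends to zero because
  -- `u` and its derivative do.
  have hμ1 : ‖μ‖ < 1 := by
    have hnat : Tendsto (fun n : ℕ => R + n) atTop atTop :=
      tendsto_atTop_add_const_left _ _ tendsto_natCast_atTop_atTop
    have h1 : Tendsto (fun n : ℕ => ‖u (R + n) * deriv v R - deriv u (R + n) * v R‖)
        atTop (𝓝 0) := by
      simpa using (((tu.comp hnat).mul_const (deriv v R)).sub
        ((tu'.comp hnat).mul_const (v R))).norm
    have h2 : ∀ n : ℕ, ‖u (R + n) * deriv v R - deriv u (R + n) * v R‖ = ‖μ‖ ^ n := fun n => by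
      rw [(hpow n).1, (hpow n).2, ← norm_pow]
      congr 1
      linear_combination μ ^ n * hF.wronskian R
    simp only [h2] at h1
    simpa using tendsto_pow_atTop_nhds_zero_iff.1 h1
  have hμpos : 0 < ‖μ‖ := norm_pos_iff.2 hμ0
  have Wv : ∀ x, R ≤ x → u x * deriv v (x + 1) - deriv u x * v (x + 1) = μ⁻¹ := fun x hx => by
    have h1 := hF.wronskian (x + 1)
    rw [u1 x hx, u1' x hx] at h1
    refine eq_inv_of_mul_eq_one_left ?_
    linear_combination h1
  have v1 : ∀ x, R ≤ x → v (x + 1) = ν * u x + μ⁻¹ * v x := fun x hx => by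
    linear_combination u x * Wν x hx + v x * Wv x hx - v (x + 1) * hF.wronskian x
  have v1' : ∀ x, R ≤ x → deriv v (x + 1) = ν * deriv u x + μ⁻¹ * deriv v x := fun x hx => by
    linear_combination deriv u x * Wν x hx + deriv v x * Wv x hx
      - deriv v (x + 1) * hF.wronskian x
  have hne : μ⁻¹ - μ ≠ 0 := by
    intro h0
    have h1 : μ * μ = 1 := by
      field_simp at h0
      linear_combination -h0
    have h2 : ‖μ‖ * ‖μ‖ = 1 := by rw [← norm_mul, h1, norm_one]
    nlinarith
  -- Translation by one acts on the basis `u`, `v` as a triangular matrix with diagonal `μ`, `μ⁻¹`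
  -- and off-diagonal entry `ν`. This `d` diagonalises it: `v + d u` is a Floquet solution with
  -- multiplier `μ⁻¹`.
  obtain ⟨d, hd⟩ : ∃ d, d = ν / (μ⁻¹ - μ) := ⟨_, rfl⟩
  have hd' : ν + d * μ = μ⁻¹ * d := by
    have : d * (μ⁻¹ - μ) = ν := by rw [hd, div_mul_cancel₀ _ hne]
    linear_combination -this
  have hu := hF.left.continuous
  have hu' := hF.left.continuous_deriv
  have hv := hF.right.continuous
  have hv' := hF.right.continuous_deriv
  obtain ⟨lam, hlam⟩ : ∃ lam, lam = -Real.log ‖μ‖ := ⟨_, rfl⟩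
  have hlam0 : 0 < lam := by rw [hlam]; linarith [Real.log_neg hμpos hμ1]
  have e1 : ‖μ‖ = Real.exp (-lam) := by rw [hlam, neg_neg, Real.exp_log hμpos]
  have e2 : ‖μ⁻¹‖ = Real.exp lam := by rw [norm_inv, e1, ← Real.exp_neg, neg_neg]
  obtain ⟨C₁, h10, h1⟩ := exists_exp_bound_of_multiplier hu e1 u1
  obtain ⟨C₂, h20, h2⟩ := exists_exp_bound_of_multiplier hu' e1 u1'
  obtain ⟨C₃, h30, h3⟩ := exists_exp_bound_of_multiplier (f := fun x => v x + d * u x)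
    (by fun_prop) e2 (fun x hx => by
      rw [v1 x hx, u1 x hx]; linear_combination u x * hd')
  obtain ⟨C₄, h40, h4⟩ := exists_exp_bound_of_multiplier
    (f := fun x => deriv v x + d * deriv u x) (by fun_prop) e2 (fun x hx => by
      rw [v1' x hx, u1' x hx]; linear_combination deriv u x * hd')
  obtain ⟨C, hC⟩ : ∃ C, C = C₁ + C₂ + C₃ + C₄ + ‖d‖ * C₁ + ‖d‖ * C₂ := ⟨_, rfl⟩
  have hdn := norm_nonneg d
  have hdC₁ : 0 ≤ ‖d‖ * C₁ := by positivity
  have hdC₂ : 0 ≤ ‖d‖ * C₂ := by positivity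
  have hle : ∀ t : ℝ, 0 ≤ t → Real.exp (-lam * t) ≤ Real.exp (lam * t) := fun t ht =>
    Real.exp_le_exp.2 (by nlinarith)
  have hsum : ∀ (A B : ℂ) (c c' t : ℝ), 0 ≤ t → 0 ≤ c' → ‖A + d * B‖ ≤ c * Real.exp (lam * t) →
      ‖B‖ ≤ c' * Real.exp (-lam * t) → c + ‖d‖ * c' ≤ C → ‖A‖ ≤ C * Real.exp (lam * t) := by
    intro A B c c' t ht hc' hA hB hcC
    calc ‖A‖ = ‖(A + d * B) - d * B‖ := by congr 1; ring
      _ ≤ ‖A + d * B‖ + ‖d * B‖ := norm_sub_le _ _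
      _ ≤ c * Real.exp (lam * t) + ‖d‖ * (c' * Real.exp (lam * t)) := by
        rw [norm_mul]
        have := hB.trans (mul_le_mul_of_nonneg_left (hle t ht) hc')
        gcongr
      _ = (c + ‖d‖ * c') * Real.exp (lam * t) := by ring
      _ ≤ _ := by gcongr
  refine ⟨lam, C, hlam0, fun M => ⟨hlam0.le, fun t ht => ?_, fun t ht => ?_, fun t ht => ?_,
    fun t ht => ?_⟩⟩
  · exact (h1 t ht.1).trans (by gcongr; linarith)
  · exact (h2 t ht.1).trans (by gcongr; linarith)
  · exact hsum _ _ _ _ t ht.1 h10 (h3 t ht.1) (h1 t ht.1) (by linarith)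
  · exact hsum _ _ _ _ t ht.1 h20 (h4 t ht.1) (h2 t ht.1) (by linarith)

end Floquet

/-! ### A quantitative Newton lemma for holomorphic functions. -/

section NewtonRoot

open Set Filter Topology Metric

/-- If a holomorphic function bounded by `B` on a ball of radius `R` has a small value at the centre
and a large derivative there, then it has exactly one zero in a small concentric ball, and the
zero is quadratically close to the Newton step. -/
theorem exists_unique_root_near {f : ℂ → ℂ} {c : ℂ} {R B r L : ℝ} (hR : 0 < R) (hr : 0 < r)
    (hf : DifferentiableOn ℂ f (ball c R)) (hB : ∀ z ∈ ball c R, ‖f z‖ ≤ B)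
    (hL : L = 16 * B / R ^ 2) (hrR : 4 * r ≤ R) (hLr : 2 * (L * r) ≤ ‖deriv f c‖)
    (hfc : 2 * ‖f c‖ ≤ ‖deriv f c‖ * r) (hd : deriv f c ≠ 0) :
    ∃ w, ‖w - c‖ ≤ r ∧ f w = 0 ∧ (∀ z, ‖z - c‖ ≤ r → f z = 0 → z = w) ∧
      ‖w - (c - f c / deriv f c)‖ ≤ 4 * L * ‖f c‖ ^ 2 / ‖deriv f c‖ ^ 3 := by
  have hm : 0 < ‖deriv f c‖ := norm_pos_iff.2 hd
  have hB0 : 0 ≤ B := (norm_nonneg _).trans (hB c (mem_ball_self hR))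
  have hL0 : 0 ≤ L := by rw [hL]; positivity
  have hf' : DifferentiableOn ℂ (deriv f) (ball c R) := hf.deriv isOpen_ball
  have cauchy : ∀ (g : ℂ → ℂ) (K ρ s : ℝ), 0 < s → s + ρ < R → DifferentiableOn ℂ g (ball c R) →
      (∀ z, ‖z - c‖ ≤ s + ρ → ‖g z‖ ≤ K) → ∀ z, ‖z - c‖ ≤ ρ → ‖deriv g z‖ ≤ K / s := by
    intro g K ρ s hs hsr hg hK z hz
    have hsub : ∀ w, ‖w - z‖ ≤ s → ‖w - c‖ ≤ s + ρ := fun w hw => by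
      calc ‖w - c‖ = ‖(w - z) + (z - c)‖ := by ring_nf
        _ ≤ _ := (norm_add_le _ _).trans (add_le_add hw hz)
    refine Complex.norm_deriv_le_of_forall_mem_sphere_norm_le hs ?_ fun w hw => ?_
    · refine DifferentiableOn.diffContOnCl (hg.mono ?_)
      rw [closure_ball z hs.ne']
      intro w hw
      rw [mem_closedBall, dist_eq_norm] at hw
      rw [mem_ball, dist_eq_norm]
      exact (hsub w hw).trans_lt hsr
    · rw [mem_sphere, dist_eq_norm] at hw
      exact hK w (hsub w hw.le)
  -- Two Cauchy estimates on circles of radius `R / 4` bound `f'` on radius `R / 2` and then `f''`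
  -- on radius `R / 4`; together they give `16 B / R²`.
  have h1 : ∀ z, ‖z - c‖ ≤ R / 2 → ‖deriv f z‖ ≤ B / (R / 4) :=
    cauchy f B (R / 2) (R / 4) (by positivity) (by linarith) hf fun z hz => hB z (by
      rw [mem_ball, dist_eq_norm]; linarith)
  have h2 : ∀ z, ‖z - c‖ ≤ R / 4 → ‖deriv (deriv f) z‖ ≤ L := by
    intro z hz
    refine (cauchy (deriv f) _ (R / 4) (R / 4) (by positivity) (by linarith) hf'
      (fun z hz => h1 z (by linarith)) z hz).trans (le_of_eq ?_)
    rw [hL]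
    field_simp
    norm_num
  have hball : ∀ ρ, ρ ≤ R / 4 → closedBall c ρ ⊆ ball c R := fun ρ hρ =>
    closedBall_subset_ball (by linarith)
  have h3 : ∀ z, ‖z - c‖ ≤ R / 4 → ‖deriv f z - deriv f c‖ ≤ L * ‖z - c‖ := by
    intro z hz
    refine (convex_closedBall c (R / 4)).norm_image_sub_le_of_norm_hasDerivWithin_le
      (fun w hw => ((hf'.differentiableAt (isOpen_ball.mem_nhds
        (hball _ le_rfl hw))).hasDerivAt).hasDerivWithinAt) (fun w hw => h2 w ?_)
      (mem_closedBall_self (by positivity)) ?_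
    · simpa [dist_eq_norm] using hw
    · simpa [dist_eq_norm] using hz
  have h4 : ∀ ρ, ρ ≤ R / 4 → ∀ z w, ‖z - c‖ ≤ ρ → ‖w - c‖ ≤ ρ →
      ‖f z - f w - deriv f c * (z - w)‖ ≤ L * ρ * ‖z - w‖ := by
    intro ρ hρ z w hz hw
    have h5 := (convex_closedBall c ρ).norm_image_sub_le_of_norm_hasDerivWithin_le
      (f := fun z => f z - deriv f c * z) (f' := fun z => deriv f z - deriv f c) (C := L * ρ)
      (x := w) (y := z)
      (fun x hx => by
        have h6 := (hf.differentiableAt (isOpen_ball.mem_nhds (hball _ hρ hx))).hasDerivAt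
        have h7 := (hasDerivAt_id x).const_mul (deriv f c)
        exact ((h6.sub h7).congr_deriv (by simp)).hasDerivWithinAt)
      (fun x hx => by
        have hx' : ‖x - c‖ ≤ ρ := by simpa [dist_eq_norm] using hx
        exact (h3 x (hx'.trans hρ)).trans (by gcongr))
      (by simpa [dist_eq_norm] using hw) (by simpa [dist_eq_norm] using hz)
    refine le_trans (le_of_eq ?_) h5
    congr 1
    ring
  have hr4 : r ≤ R / 4 := by linarith
  -- The simplified Newton map, with the derivative frozen at the centre. By `h4` and `2 L r ≤ |f'
  -- c|` it contracts by `1 / 2`, and its fixed points are the zeros of `f`.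
  obtain ⟨N, hN⟩ : ∃ N : ℂ → ℂ, N = fun z => z - f z / deriv f c := ⟨_, rfl⟩
  have hNlip : ∀ z w, ‖z - c‖ ≤ r → ‖w - c‖ ≤ r → ‖N z - N w‖ ≤ 1 / 2 * ‖z - w‖ := by
    intro z w hz hw
    have h5 := h4 r hr4 z w hz hw
    have h6 : N z - N w = -(f z - f w - deriv f c * (z - w)) / deriv f c := by
      rw [hN]; field_simp; ring
    rw [h6, norm_div, norm_neg, div_le_iff₀ hm]
    have := norm_nonneg (z - w)
    nlinarith
  have hNmaps : MapsTo N (closedBall c r) (closedBall c r) := by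
    intro z hz
    rw [mem_closedBall, dist_eq_norm] at hz ⊢
    have h5 := hNlip z c hz (by simpa using hr.le)
    have h6 : ‖N c - c‖ ≤ r / 2 := by
      have : N c - c = -(f c / deriv f c) := by rw [hN]; ring
      rw [this, norm_neg, norm_div, div_le_iff₀ hm]
      linarith
    calc ‖N z - c‖ = ‖(N z - N c) + (N c - c)‖ := by ring_nf
      _ ≤ ‖N z - N c‖ + ‖N c - c‖ := norm_add_le _ _
      _ ≤ r := by linarith
  have hcontr : ContractingWith (1 / 2) (hNmaps.restrict N _ _) := by
    refine ⟨by norm_num, LipschitzWith.of_dist_le_mul fun z w => ?_⟩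
    have hz : ‖(z : ℂ) - c‖ ≤ r := by rw [← dist_eq_norm]; exact z.2
    have hw : ‖(w : ℂ) - c‖ ≤ r := by rw [← dist_eq_norm]; exact w.2
    rw [Subtype.dist_eq, Subtype.dist_eq, dist_eq_norm, dist_eq_norm]
    simpa using hNlip z w hz hw
  obtain ⟨w, hwmem, hwfix, -⟩ := hcontr.exists_fixedPoint' isClosed_closedBall.isComplete hNmaps
    (x := c) (mem_closedBall_self hr.le) (edist_ne_top _ _)
  have hw : ‖w - c‖ ≤ r := by simpa [dist_eq_norm] using hwmem
  have hw0 : f w = 0 := by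
    have h5 : w - f w / deriv f c = w := by
      have : N w = w := hwfix
      rwa [hN] at this
    have h6 : f w / deriv f c = 0 := by linear_combination -h5
    simpa [hd] using h6
  refine ⟨w, hw, hw0, fun z hz hz0 => ?_, ?_⟩
  · have h5 := hNlip z w hz hw
    have h6 : N z - N w = z - w := by rw [hN]; simp [hz0, hw0]
    rw [h6] at h5
    have h7 : ‖z - w‖ ≤ 0 := by linarith
    exact sub_eq_zero.1 (norm_le_zero_iff.1 h7)
  -- Using the radius `‖w - c‖` instead of `r` makes the linearisation error `L ‖w - c‖²`; with `‖w
  -- - c‖ ≤ 2 ‖f c‖ / ‖deriv f c‖` this becomes the Newton error.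
  · have h5 := h4 ‖w - c‖ (hw.trans hr4) w c le_rfl (by simp)
    rw [hw0] at h5
    have h6 : ‖deriv f c‖ * ‖w - c‖ ≤ 2 * ‖f c‖ := by
      have h7 : ‖deriv f c * (w - c)‖ ≤ ‖f c‖ + L * ‖w - c‖ * ‖w - c‖ := by
        calc ‖deriv f c * (w - c)‖ = ‖-f c - (0 - f c - deriv f c * (w - c))‖ := by
              congr 1; ring
          _ ≤ ‖-f c‖ + ‖0 - f c - deriv f c * (w - c)‖ := norm_sub_le _ _
          _ ≤ _ := by rw [norm_neg]; gcongr
      rw [norm_mul] at h7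
      have h8 : L * ‖w - c‖ * ‖w - c‖ ≤ L * r * ‖w - c‖ := by gcongr
      have h9 := norm_nonneg (w - c)
      nlinarith
    have h7 : w - (c - f c / deriv f c) = -(0 - f c - deriv f c * (w - c)) / deriv f c := by
      field_simp; ring
    have h8 : ‖w - c‖ ≤ 2 * ‖f c‖ / ‖deriv f c‖ := by
      rw [le_div_iff₀ hm]; linarith
    rw [h7, norm_div, norm_neg, div_le_iff₀ hm]
    calc _ ≤ L * ‖w - c‖ * ‖w - c‖ := h5
      _ ≤ L * (2 * ‖f c‖ / ‖deriv f c‖) * (2 * ‖f c‖ / ‖deriv f c‖) := by gcongr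
      _ = _ := by field_simp; ring

end NewtonRoot

/-! ### Gluing exponential tails to obtain a bound state of the truncated potential. -/

section TruncatedBoundState

open Set Filter Topology MeasureTheory

theorem hasDerivAt_ite_le {f g f' g' : ℝ → ℂ} {c : ℝ} (hf : ∀ x, HasDerivAt f (f' x) x)
    (hg : ∀ x, HasDerivAt g (g' x) x) (h : f c = g c) (h' : f' c = g' c) (x : ℝ) :
    HasDerivAt (fun x => if x ≤ c then f x else g x) (if x ≤ c then f' x else g' x) x := by
  rcases lt_trichotomy x c with hx | rfl | hx
  · rw [if_pos hx.le]
    refine (hf x).congr_of_eventuallyEq ?_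
    filter_upwards [Iio_mem_nhds hx] with t ht
    rw [if_pos (le_of_lt ht)]
  · rw [if_pos le_rfl, ← hasDerivWithinAt_univ, ← Iic_union_Ici (a := x)]
    refine HasDerivWithinAt.union ?_ ?_
    · exact (hf x).hasDerivWithinAt.congr (fun t ht => if_pos ht) (if_pos le_rfl)
    · rw [h']
      refine (hg x).hasDerivWithinAt.congr (fun t ht => ?_) (by rw [if_pos le_rfl, h])
      rcases eq_or_lt_of_le (mem_Ici.1 ht) with rfl | hlt
      · rw [if_pos le_rfl, h]
      · rw [if_neg (not_le.2 hlt)]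
  · rw [if_neg (not_le.2 hx)]
    refine (hg x).congr_of_eventuallyEq ?_
    filter_upwards [Ioi_mem_nhds hx] with t ht
    rw [if_neg (not_le.2 ht)]

theorem memLp_exp_neg_mul_abs {κ : ℝ} (hκ : 0 < κ) :
    MemLp (fun x : ℝ => Real.exp (-κ * |x|)) 2 volume := by
  have hc : Continuous fun x : ℝ => Real.exp (-κ * |x|) := by fun_prop
  rw [memLp_two_iff_integrable_sq hc.aestronglyMeasurable, ← integrableOn_univ,
    ← Iic_union_Ioi (a := (0 : ℝ))]
  refine IntegrableOn.union ?_ ?_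
  · refine (integrableOn_exp_mul_Iic (a := 2 * κ) (by positivity) 0).congr_fun (fun x hx => ?_)
      measurableSet_Iic
    simp only [abs_of_nonpos (mem_Iic.1 hx), ← Real.exp_nat_mul]
    congr 1
    push_cast
    ring
  · refine (integrableOn_exp_mul_Ioi (a := -(2 * κ)) (by linarith) 0).congr_fun (fun x hx => ?_)
      measurableSet_Ioi
    simp only [abs_of_pos (mem_Ioi.1 hx), ← Real.exp_nat_mul]
    congr 1
    push_cast
    ring

/-- A solution of definite parity that satisfies the matching condition at `M` continues
exponentially to a bound state of the truncated potential. -/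
theorem exists_isBoundState_truncPotential {V : ℝ → ℝ} (hV : Continuous V) {lam κ M : ℝ}
    {a b σ : ℂ} {y : ℝ → ℂ} (hy : IsSchrodingerIVP V lam a b y) (hM : 0 < M) (hκ : 0 < κ)
    (hlam : κ ^ 2 = -lam) (hσ : ‖σ‖ = 1) (hpar : ∀ x, y (-x) = σ * y x)
    (hpar' : ∀ x, deriv y (-x) = -(σ * deriv y x)) (hne : a ≠ 0 ∨ b ≠ 0)
    (hmatch : deriv y M + κ * y M = 0) :
    ∃ Ψ : ℝ → ℂ, IsBoundState (truncPotential V M) lam Ψ := by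
  have hmatch' : deriv y M = -κ * y M := by linear_combination hmatch
  have hexp : ∀ (A : ℂ) (c d : ℝ) (x : ℝ), HasDerivAt
      (fun x : ℝ => A * Complex.exp (c * (x + d))) (A * (c * Complex.exp (c * (x + d)))) x := by
    intro A c d x
    have h1 : HasDerivAt (fun x : ℝ => (c * (x + d) : ℂ)) (c * 1) x :=
      ((Complex.ofRealCLM.hasDerivAt (x := x)).add_const _).const_mul _
    refine (h1.cexp.const_mul A).congr_deriv ?_
    ring
  obtain ⟨r, hr⟩ : ∃ r : ℝ → ℂ, r = fun x : ℝ => y M * Complex.exp ((-κ : ℝ) * (x + (-M : ℝ))) :=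
    ⟨_, rfl⟩
  obtain ⟨l, hl⟩ : ∃ l : ℝ → ℂ, l = fun x : ℝ => σ * y M * Complex.exp (κ * (x + M)) := ⟨_, rfl⟩
  have hrd : ∀ x, HasDerivAt r (-κ * r x) x := fun x => by
    rw [hr]
    refine (hexp (y M) (-κ) (-M) x).congr_deriv ?_
    push_cast
    ring
  have hld : ∀ x, HasDerivAt l (κ * l x) x := fun x => by
    rw [hl]
    refine (hexp (σ * y M) κ M x).congr_deriv ?_
    ring
  have hrM : r M = y M := by rw [hr]; simp
  have hlM : l (-M) = y (-M) := by rw [hl, hpar]; simp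
  obtain ⟨g, hg⟩ : ∃ g : ℝ → ℂ, g = fun x => if x ≤ M then y x else r x := ⟨_, rfl⟩
  obtain ⟨g', hg'⟩ : ∃ g' : ℝ → ℂ, g' = fun x => if x ≤ M then deriv y x else -κ * r x :=
    ⟨_, rfl⟩
  obtain ⟨Ψ, hΨ⟩ : ∃ Ψ : ℝ → ℂ, Ψ = fun x => if x ≤ -M then l x else g x := ⟨_, rfl⟩
  obtain ⟨Ψ', hΨ'⟩ : ∃ Ψ' : ℝ → ℂ, Ψ' = fun x => if x ≤ -M then κ * l x else g' x := ⟨_, rfl⟩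
  have hgd : ∀ x, HasDerivAt g (g' x) x := fun x => by
    rw [hg, hg']
    exact hasDerivAt_ite_le hy.hasDerivAt hrd hrM.symm (by rw [hrM, hmatch']) x
  have hΨd : ∀ x, HasDerivAt Ψ (Ψ' x) x := fun x => by
    rw [hΨ, hΨ']
    refine hasDerivAt_ite_le hld hgd ?_ ?_ x
    · rw [hlM, hg]
      exact (if_pos (by linarith)).symm
    · rw [hlM, hg']
      simp only
      rw [if_pos (by linarith), hpar', hpar, hmatch']
      ring
  have hdΨ : deriv Ψ = Ψ' := funext fun x => (hΨd x).deriv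
  have hΨmid : ∀ x, |x| < M → Ψ x = y x := fun x hx => by
    rw [hΨ, hg]
    simp only
    rw [if_neg (not_le.2 (abs_lt.1 hx).1), if_pos (abs_lt.1 hx).2.le]
  have hΨcont : Continuous Ψ := continuous_iff_continuousAt.2 fun x => (hΨd x).continuousAt
  have hlc : Continuous l := continuous_iff_continuousAt.2 fun x => (hld x).continuousAt
  have hrc : Continuous r := continuous_iff_continuousAt.2 fun x => (hrd x).continuousAt
  have hyc := hy.continuous_deriv
  have hg'c : Continuous g' := by
    rw [hg']
    refine Continuous.if_le hyc (continuous_const.mul hrc) continuous_id continuous_const ?_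
    rintro x rfl
    rw [hrM, hmatch']
  have hΨ'c : Continuous Ψ' := by
    rw [hΨ']
    refine Continuous.if_le (continuous_const.mul hlc) hg'c continuous_id continuous_const ?_
    rintro x hx
    rw [hx, hlM, hg']
    simp only
    rw [if_pos (by linarith), hpar', hpar, hmatch']
    ring
  have hκ2 : (κ : ℂ) ^ 2 = -lam := by exact_mod_cast hlam
  -- The truncated potential may jump at `±M`, so the second derivative is claimed only elsewhere.
  -- As `Ψ'` is continuous, these two points do not affect the integrated equation.
  have hsecond : ∀ x, x ≠ -M → x ≠ M →
      HasDerivAt Ψ' (((truncPotential V M x : ℂ) - lam) * Ψ x) x := by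
    intro x hx1 hx2
    rcases lt_or_gt_of_ne hx1 with h1 | h1
    · have ht : truncPotential V M x = 0 := by
        rw [truncPotential, if_neg]
        rw [not_le, abs_of_neg (by linarith)]
        linarith
      have hΨx : Ψ x = l x := by rw [hΨ]; simp only; rw [if_pos h1.le]
      rw [ht, hΨx]
      refine (((hld x).const_mul (κ : ℂ)).congr_deriv ?_).congr_of_eventuallyEq ?_
      · push_cast
        linear_combination l x * hκ2
      · filter_upwards [Iio_mem_nhds h1] with t ht
        rw [hΨ']
        exact if_pos (le_of_lt ht)
    rcases lt_or_gt_of_ne hx2 with h2 | h2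
    · have hx : |x| < M := abs_lt.2 ⟨h1, h2⟩
      rw [truncPotential, if_pos hx.le, hΨmid x hx]
      refine (hy.hasDerivAt_deriv x).congr_of_eventuallyEq ?_
      filter_upwards [Ioi_mem_nhds h1, Iio_mem_nhds h2] with t ht1 ht2
      rw [hΨ', hg']
      simp only
      rw [if_neg (not_le.2 ht1), if_pos (le_of_lt ht2)]
    · have ht : truncPotential V M x = 0 := by
        rw [truncPotential, if_neg]
        rw [not_le]
        exact lt_of_lt_of_le h2 (le_abs_self x)
      have hΨx : Ψ x = r x := by
        rw [hΨ, hg]; simp only; rw [if_neg (not_le.2 h1), if_neg (not_le.2 h2)]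
      rw [ht, hΨx]
      refine (((hrd x).const_mul (-κ : ℂ)).congr_deriv ?_).congr_of_eventuallyEq ?_
      · push_cast
        linear_combination r x * hκ2
      · filter_upwards [Ioi_mem_nhds h1, Ioi_mem_nhds h2] with t ht1 ht2
        rw [hΨ', hg']
        simp only
        rw [if_neg (not_le.2 ht1), if_neg (not_le.2 ht2)]
  have hint : ∀ x x' : ℝ, IntervalIntegrable
      (fun t => ((truncPotential V M t : ℂ) - lam) * Ψ t) volume x x' := by
    intro x x'
    have h1 : (fun t => ((truncPotential V M t : ℂ) - lam) * Ψ t) = fun t =>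
        (Icc (-M) M).indicator (fun t => (V t : ℂ) * Ψ t) t - lam * Ψ t := by
      funext t
      by_cases ht : |t| ≤ M
      · rw [truncPotential, if_pos ht, indicator_of_mem (mem_Icc.2 (abs_le.1 ht))]; ring
      · rw [truncPotential, if_neg ht, indicator_of_notMem (fun h => ht (abs_le.2 (mem_Icc.1 h)))]
        push_cast; ring
    rw [h1]
    have h2 : Continuous fun t => (V t : ℂ) * Ψ t := by fun_prop
    have h3 : Continuous fun t => (lam : ℂ) * Ψ t := by fun_prop
    refine IntervalIntegrable.sub ?_ (h3.intervalIntegrable _ _)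
    exact ⟨(h2.intervalIntegrable x x').1.indicator measurableSet_Icc,
      (h2.intervalIntegrable x x').2.indicator measurableSet_Icc⟩
  refine ⟨Ψ, ?_, ?_, fun x => (hΨd x).differentiableAt, hint, fun x x' => ?_⟩
  · obtain ⟨B, hB⟩ := isCompact_Icc.exists_bound_of_continuousOn (s := Icc (-M) M)
      hy.continuous.continuousOn
    have hB0 : 0 ≤ B := (norm_nonneg _).trans (hB M ⟨by linarith, le_rfl⟩)
    have hbound : ∀ x, ‖Ψ x‖ ≤ ‖(B * Real.exp (κ * M)) * Real.exp (-κ * |x|)‖ := by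
      intro x
      rw [Real.norm_of_nonneg (by positivity), mul_assoc, ← Real.exp_add]
      have hyM := hB M ⟨by linarith, le_rfl⟩
      by_cases h1 : x ≤ -M
      · have hΨx : Ψ x = l x := by rw [hΨ]; simp only; rw [if_pos h1]
        rw [hΨx, hl]
        simp only
        rw [norm_mul, norm_mul, hσ, one_mul, Complex.norm_exp, abs_of_nonpos (by linarith)]
        refine mul_le_mul hyM (Real.exp_le_exp.2 (le_of_eq ?_)) (Real.exp_pos _).le hB0
        simp
        ring
      by_cases h2 : x ≤ M
      · push Not at h1
        rw [hΨ, hg]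
        simp only
        rw [if_neg (not_le.2 h1), if_pos h2]
        refine (hB x ⟨h1.le, h2⟩).trans (le_mul_of_one_le_right hB0 (Real.one_le_exp ?_))
        have : |x| ≤ M := abs_le.2 ⟨h1.le, h2⟩
        nlinarith
      · have hΨx : Ψ x = r x := by
          rw [hΨ, hg]; simp only; rw [if_neg h1, if_neg h2]
        push Not at h2
        rw [hΨx, hr]
        simp only
        rw [norm_mul, Complex.norm_exp, abs_of_nonneg (by linarith)]
        refine mul_le_mul hyM (Real.exp_le_exp.2 (le_of_eq ?_)) (Real.exp_pos _).le hB0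
        simp
        ring
    exact ((memLp_exp_neg_mul_abs hκ).const_mul (B * Real.exp (κ * M))).of_le
      hΨcont.aestronglyMeasurable (ae_of_all _ hbound)
  -- If the glued function vanished, `y` would vanish near `0`, against its nonzero initial data.
  · intro h0
    have hev : y =ᶠ[𝓝 0] fun _ => (0 : ℂ) := by
      filter_upwards [Ioo_mem_nhds (neg_lt_zero.2 hM) hM] with t ht
      rw [← hΨmid t (abs_lt.2 ht), h0]
      rfl
    rcases hne with ha | hb
    · exact ha (hy.value_zero ▸ hev.eq_of_nhds)
    · refine hb (hy.deriv_zero ▸ ?_)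
      rw [hev.deriv_eq, deriv_const]
  · rw [hdΨ]
    refine (MeasureTheory.integral_eq_of_hasDerivAt_off_countable Ψ' _
      (s := {-M, M}) (by simp) hΨ'c.continuousOn (fun t ht => ?_) (hint x x')).symm
    have h2 := ht.2
    simp only [mem_insert_iff, mem_singleton_iff, not_or] at h2
    exact hsecond t h2.1 h2.2

end TruncatedBoundState

/-! ### Symmetries, the branch of the root, and the derivative of `Θ`. -/

section TruncationEigenvalue

open Set Filter Topology MeasureTheory

theorem IsBoundState.isSchrodingerIVP {V : ℝ → ℝ} (hV : Continuous V) {E : ℝ} {Φ : ℝ → ℂ}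
    (hΦ : IsBoundState V E Φ) : IsSchrodingerIVP V E (Φ 0) (deriv Φ 0) Φ := by
  refine .of_hasDerivAt (fun x => (hΦ.differentiable x).hasDerivAt) (fun x => ?_) rfl rfl
  have hc : Continuous fun t => ((V t : ℂ) - E) * Φ t := by
    have := hΦ.differentiable.continuous
    fun_prop
  have h1 : deriv Φ = fun x => deriv Φ 0 + ∫ t in (0 : ℝ)..x, ((V t : ℂ) - E) * Φ t := by
    funext x
    linear_combination hΦ.equation 0 x
  rw [h1]
  exact (intervalIntegral.integral_hasDerivAt_right (hc.intervalIntegrable _ _)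
    (hc.stronglyMeasurableAtFilter _ _) hc.continuousAt).const_add _

/-- The solutions `u_z` and `v_z` have real initial data of Wronskian one, `u_z` has a definite
parity `σ`, and it is square integrable at the energy of the bound state. -/
theorem IsBoundState.exists_initial_data {V : ℝ → ℝ} (hV : Continuous V)
    (hEven : ∀ x, V (-x) = V x) {E : ℝ} {Φ : ℝ → ℂ} (hΦ : IsBoundState V E Φ) :
    ∃ p q r s σ : ℝ, p * s - q * r = 1 ∧ |σ| = 1 ∧ p = σ * p ∧ -q = σ * q ∧
      (∀ z, uSol V Φ z = schrodingerSol V z p q) ∧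
      (∀ z, vSol V Φ z = schrodingerSol V z r s) ∧
      MemLp (schrodingerSol V E p q) 2 volume := by
  have hS := hΦ.isSchrodingerIVP hV
  by_cases h : ∀ x, Φ (-x) = Φ x
  · refine ⟨1, 0, 0, 1, 1, by norm_num, by norm_num, by norm_num, by norm_num, fun z => ?_,
      fun z => ?_, ?_⟩
    · rw [uSol, if_pos h]; simp
    · rw [vSol, if_pos h]; simp
    · have hd : deriv Φ 0 = 0 := by
        have h1 := (hS.comp_neg hEven).deriv_zero
        simp only [h] at h1
        change deriv Φ 0 = _ at h1
        linear_combination h1 / 2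
      have h0 : Φ 0 ≠ 0 := by
        intro h0
        rw [hd, h0] at hS
        have hz : IsSchrodingerIVP V E 0 0 (fun x => 0 * Φ x) := by simpa using hS.const_mul 0
        refine hΦ.ne_zero ((hS.unique hV hz).trans ?_)
        funext x
        simp
      have h1 := hS.const_mul (Φ 0)⁻¹
      rw [hd, inv_mul_cancel₀ h0, mul_zero] at h1
      have h2 := (schrodingerSol_spec hV (E : ℂ) 1 0).unique hV h1
      push_cast
      rw [h2]
      exact hΦ.memLp.const_mul _
  · refine ⟨0, 1, -1, 0, -1, by norm_num, by norm_num, by norm_num, by norm_num, fun z => ?_,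
      fun z => ?_, ?_⟩
    · rw [uSol, if_neg h]; simp
    · rw [vSol, if_neg h]; simp
    -- Oddness of `Φ` is not needed: `Φ x - Φ (-x)` is a square integrable solution with data `(0, 2
    -- Φ' 0)`. If `Φ' 0` were zero it would vanish by uniqueness, and `Φ` would be even.
    · have hodd := hS.add ((hS.comp_neg hEven).const_mul (-1))
      have hd : deriv Φ 0 ≠ 0 := by
        intro hd
        refine h fun x => ?_
        rw [hd] at hodd
        have hz : IsSchrodingerIVP V E 0 0 (fun x => 0 * Φ x) := by simpa using hS.const_mul 0
        have hodd' : IsSchrodingerIVP V E 0 0 (fun x => Φ x + -1 * Φ (-x)) := by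
          simpa using hodd
        have h1 := congrFun (hodd'.unique hV hz) x
        linear_combination -h1
      have h1 := hodd.const_mul (2 * deriv Φ 0)⁻¹
      have e1 : (2 * deriv Φ 0)⁻¹ * (Φ 0 + -1 * Φ 0) = 0 := by ring
      have e2 : (2 * deriv Φ 0)⁻¹ * (deriv Φ 0 + -1 * -deriv Φ 0) = 1 := by
        field_simp; ring
      rw [e1, e2] at h1
      have h2 := (schrodingerSol_spec hV (E : ℂ) 0 1).unique hV h1
      push_cast
      rw [h2]
      have hneg : MemLp (fun x => Φ (-x)) 2 volume :=
        hΦ.memLp.comp_measurePreserving (Measure.measurePreserving_neg volume)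
      exact (hΦ.memLp.add (hneg.const_mul (-1))).const_mul _

theorem conj_schrodingerSol {V : ℝ → ℝ} (hV : Continuous V) (z : ℂ) (p q x : ℝ) :
    schrodingerSol V (starRingEnd ℂ z) p q x = starRingEnd ℂ (schrodingerSol V z p q x) ∧
      deriv (schrodingerSol V (starRingEnd ℂ z) p q) x =
        starRingEnd ℂ (deriv (schrodingerSol V z p q) x) := by
  have hS := schrodingerSol_spec hV z p q
  have h1 := hS.conj
  rw [Complex.conj_ofReal, Complex.conj_ofReal] at h1
  rw [(schrodingerSol_spec hV (starRingEnd ℂ z) p q).unique hV h1]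
  exact ⟨rfl, ((hS.hasDerivAt x).star).deriv⟩

theorem schrodingerSol_parity {V : ℝ → ℝ} (hV : Continuous V) (hEven : ∀ x, V (-x) = V x)
    {z a b σ : ℂ} (ha : a = σ * a) (hb : -b = σ * b) (x : ℝ) :
    schrodingerSol V z a b (-x) = σ * schrodingerSol V z a b x ∧
      deriv (schrodingerSol V z a b) (-x) = -(σ * deriv (schrodingerSol V z a b) x) := by
  have hS := schrodingerSol_spec hV z a b
  have h2 := hS.const_mul σ
  rw [← ha, ← hb] at h2
  have h3 := (hS.comp_neg hEven).unique hV h2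
  refine ⟨congrFun h3 x, ?_⟩
  have h4 : HasDerivAt (fun x => schrodingerSol V z a b (-x))
      (-deriv (schrodingerSol V z a b) (-x)) x :=
    ((hS.hasDerivAt (-x)).scomp x (hasDerivAt_neg x)).congr_deriv (by simp)
  rw [h3] at h4
  linear_combination -(h4.unique ((hS.hasDerivAt x).const_mul σ))

/-- In this form the coefficient is the principal square root of `-z`, which is holomorphic off `[0,
∞)`, positive at negative energies and compatible with conjugation. -/
theorem Theta_eq (V : ℝ → ℝ) (Φ : ℝ → ℂ) (M : ℝ) (z : ℂ) :
    Theta V Φ M z = deriv (uSol V Φ z) M + (-z) ^ (1 / 2 : ℂ) * uSol V Φ z M := by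
  rw [Theta, sqrtUpper]
  linear_combination -((-z) ^ (1 / 2 : ℂ) * uSol V Φ z M) * Complex.I_mul_I

theorem neg_ofReal_cpow_half {x : ℝ} (hx : x < 0) :
    (-(x : ℂ)) ^ (1 / 2 : ℂ) = (Real.sqrt (-x) : ℂ) := by
  rw [Real.sqrt_eq_rpow, Complex.ofReal_cpow (by linarith)]
  push_cast
  rfl

theorem neg_mem_slitPlane_of_re_neg {z : ℂ} (hz : z.re < 0) : -z ∈ Complex.slitPlane :=
  Complex.mem_slitPlane_iff.2 (.inl (by simpa using hz))

theorem hasDerivAt_neg_cpow_half {z : ℂ} (hz : z.re < 0) :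
    HasDerivAt (fun z : ℂ => (-z) ^ (1 / 2 : ℂ))
      (deriv (fun z : ℂ => (-z) ^ (1 / 2 : ℂ)) z) z :=
  ((hasDerivAt_neg z).cpow_const (neg_mem_slitPlane_of_re_neg hz)).differentiableAt.hasDerivAt

theorem conj_neg_cpow_half {z : ℂ} (hz : z.re < 0) :
    (-(starRingEnd ℂ z)) ^ (1 / 2 : ℂ) = starRingEnd ℂ ((-z) ^ (1 / 2 : ℂ)) := by
  rw [← map_neg, Complex.conj_cpow _ _
    (Complex.mem_slitPlane_iff_arg.1 (neg_mem_slitPlane_of_re_neg hz)).1, map_div₀, map_one, map_ofNat]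

theorem HasDichotomy.mono {u v : ℝ → ℂ} {C C' lam M : ℝ} (h : HasDichotomy u v C lam M)
    (hC : C ≤ C') : HasDichotomy u v C' lam M := by
  refine ⟨h.rate_nonneg, fun t ht => (h.left t ht).trans ?_,
    fun t ht => (h.left_deriv t ht).trans ?_, fun t ht => (h.right t ht).trans ?_,
    fun t ht => (h.right_deriv t ht).trans ?_⟩ <;> gcongr

/-- The Wronskian is one and `u`, `u'` are exponentially small at `M`, so `v` and `v'` cannot both
be small there. -/
theorem HasDichotomy.exp_le_right {V : ℝ → ℝ} {z p q r s : ℂ} {u v : ℝ → ℂ} {C lam M : ℝ}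
    (h : HasDichotomy u v C lam M) (hF : IsFundamentalPair V z p q r s u v) (hM : 0 ≤ M) :
    Real.exp (lam * M) ≤ C * (‖v M‖ + ‖deriv v M‖) := by
  have hMM : M ∈ Icc 0 M := ⟨hM, le_rfl⟩
  have h1 : (1 : ℝ) ≤ C * Real.exp (-lam * M) * (‖v M‖ + ‖deriv v M‖) := by
    calc (1 : ℝ) = ‖u M * deriv v M - deriv u M * v M‖ := by rw [hF.wronskian, norm_one]
      _ ≤ ‖u M‖ * ‖deriv v M‖ + ‖deriv u M‖ * ‖v M‖ := by
        rw [← norm_mul, ← norm_mul]; exact norm_sub_le _ _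
      _ ≤ (C * Real.exp (-lam * M)) * ‖deriv v M‖ + (C * Real.exp (-lam * M)) * ‖v M‖ := by
        gcongr
        · exact h.left M hMM
        · exact h.left_deriv M hMM
      _ = _ := by ring
  have e : Real.exp (-lam * M) * Real.exp (lam * M) = 1 := by rw [← Real.exp_add]; simp
  calc Real.exp (lam * M) = 1 * Real.exp (lam * M) := (one_mul _).symm
    _ ≤ C * Real.exp (-lam * M) * (‖v M‖ + ‖deriv v M‖) * Real.exp (lam * M) := by gcongr
    _ = _ := by linear_combination C * (‖v M‖ + ‖deriv v M‖) * e

/-- For real `u` the integrand is `‖u‖²`, so the integral dominates its part over `[0, 1]`. That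
part is positive, since the Wronskian prevents `u` from vanishing on an interval. -/
theorem exists_pos_le_norm_integral_sq {V : ℝ → ℝ} {z p q r s : ℂ} {u v : ℝ → ℂ}
    (hF : IsFundamentalPair V z p q r s u v) (hreal : ∀ x, starRingEnd ℂ (u x) = u x) :
    ∃ c : ℝ, 0 < c ∧ ∀ M, 1 ≤ M → c ≤ ‖∫ t in (0 : ℝ)..M, u t * u t‖ := by
  have hc : Continuous fun t => ‖u t‖ ^ 2 := by
    have := hF.left.continuous
    fun_prop
  refine ⟨∫ t in (0 : ℝ)..1, ‖u t‖ ^ 2, ?_, fun M hM => ?_⟩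
  · refine intervalIntegral.integral_pos one_pos hc.continuousOn (fun t _ => by positivity) ?_
    by_contra hcon
    push Not at hcon
    have h0 : ∀ t ∈ Icc (0 : ℝ) 1, u t = 0 := fun t ht => by
      have := hcon t ht
      exact norm_eq_zero.1 (pow_eq_zero_iff two_ne_zero |>.1 (le_antisymm this (by positivity)))
    have hev : u =ᶠ[𝓝 (1 / 2 : ℝ)] fun _ => (0 : ℂ) := by
      filter_upwards [Icc_mem_nhds (by norm_num : (0 : ℝ) < 1 / 2)
        (by norm_num : (1 / 2 : ℝ) < 1)] with t ht
      exact h0 t ht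
    have h1 := hF.wronskian (1 / 2)
    rw [hev.eq_of_nhds, hev.deriv_eq, deriv_const] at h1
    simp at h1
  · have h1 : ∀ t, u t * u t = ((‖u t‖ ^ 2 : ℝ) : ℂ) := fun t => by
      rw [← Complex.normSq_eq_norm_sq, ← Complex.mul_conj, hreal]
    simp only [h1]
    rw [intervalIntegral.integral_ofReal, Complex.norm_real]
    refine le_trans ?_ (le_abs_self _)
    refine intervalIntegral.integral_mono_interval le_rfl zero_le_one hM
      (ae_of_all _ fun t => by positivity) (hc.intervalIntegrable _ _)

theorem eventually_const_mul_sq_le_exp {k : ℝ} (hk : 0 < k) (A : ℝ) :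
    ∀ᶠ M : ℝ in atTop, A * M ^ 2 ≤ Real.exp (k * M) := by
  have h1 := (Real.tendsto_pow_mul_exp_neg_atTop_nhds_zero 2).comp
    (tendsto_id.const_mul_atTop hk)
  have h2 : Tendsto (fun M : ℝ => A / k ^ 2 * ((k * M) ^ 2 * Real.exp (-(k * M)))) atTop (𝓝 0) := by
    simpa using h1.const_mul (A / k ^ 2)
  filter_upwards [h2.eventually_le_const zero_lt_one] with M hM
  have e : Real.exp (-(k * M)) * Real.exp (k * M) = 1 := by rw [← Real.exp_add]; simp
  calc A * M ^ 2 = A / k ^ 2 * ((k * M) ^ 2 * Real.exp (-(k * M))) * Real.exp (k * M) := by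
        rw [mul_assoc, mul_assoc, e]; field_simp
    _ ≤ 1 * Real.exp (k * M) := by gcongr
    _ = _ := one_mul _

section Derivative

variable {V : ℝ → ℝ} {p q r s : ℂ}

theorem isFundamentalPair_schrodingerSol (hV : Continuous V) (hdet : p * s - q * r = 1) (z : ℂ) :
    IsFundamentalPair V z p q r s (schrodingerSol V z p q) (schrodingerSol V z r s) :=
  ⟨schrodingerSol_spec hV z p q, schrodingerSol_spec hV z r s, hdet⟩

/-- The terms are grouped by size: at the bound state energy those with `u M` and `deriv u M` are
small, and the one with `deriv v M + κ * v M` dominates. -/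
theorem hasDerivAt_matching (hV : Continuous V) (hdet : p * s - q * r = 1) {z : ℂ}
    (hz : z.re < 0) {M : ℝ} (hM : 0 ≤ M) {u v : ℝ → ℂ} (hu : u = schrodingerSol V z p q)
    (hv : v = schrodingerSol V z r s) {κ κ' : ℂ} (hκ : κ = (-z) ^ (1 / 2 : ℂ))
    (hκ' : κ' = deriv (fun z : ℂ => (-z) ^ (1 / 2 : ℂ)) z) :
    HasDerivAt (fun z => deriv (schrodingerSol V z p q) M +
        (-z) ^ (1 / 2 : ℂ) * schrodingerSol V z p q M)
      ((deriv u M + κ * u M) * (∫ t in (0 : ℝ)..M, v t * u t) + κ' * u M -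
        (deriv v M + κ * v M) * ∫ t in (0 : ℝ)..M, u t * u t) z := by
  subst hu hv hκ hκ'
  obtain ⟨h1, h2⟩ := IsFundamentalPair.hasDerivAt_param
    (y := fun z => schrodingerSol V z p q) (fun z => schrodingerSol_spec hV z p q)
    (isFundamentalPair_schrodingerSol hV hdet z) hM
  refine (h2.add ((hasDerivAt_neg_cpow_half hz).mul h1)).congr_deriv ?_
  ring

end Derivative

end TruncationEigenvalue

/-! ### Size estimates at `E` and existence of the root. -/

section TruncationTheorem

open Set Filter Topology MeasureTheory

set_option maxHeartbeats 1000000 in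
theorem exists_unique_matching_root {V : ℝ → ℝ} {ρ : ℝ} (hV : IsDefectPotential V ρ)
    {p q r s : ℝ} (hdet : p * s - q * r = 1) {E : ℝ} (hE : E < 0) {u v : ℝ → ℂ} {T : ℝ → ℂ → ℂ}
    (hu : u = schrodingerSol V E p q) (hv : v = schrodingerSol V E r s)
    (hT : T = fun M z => deriv (schrodingerSol V z p q) M +
      (-z) ^ (1 / 2 : ℂ) * schrodingerSol V z p q M) (hL : MemLp u 2 volume) :
    ∃ k : ℝ, 0 < k ∧ ∀ δ : ℝ, 0 < δ → ∃ M₀ C : ℝ, ρ < M₀ ∧ 0 < M₀ ∧ ∀ M : ℝ, M₀ ≤ M →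
      δ * (‖v M‖ + ‖deriv v M‖) ≤ ‖deriv v M + (-(E : ℂ)) ^ (1 / 2 : ℂ) * v M‖ →
      1 / M ^ 2 * Real.exp (-k * M) < -E ∧ DifferentiableAt ℂ (T M) E ∧ deriv (T M) E ≠ 0 ∧
      ∃ w : ℂ, ‖w - E‖ ≤ 1 / M ^ 2 * Real.exp (-k * M) ∧ T M w = 0 ∧
        (∀ z : ℂ, ‖z - E‖ ≤ 1 / M ^ 2 * Real.exp (-k * M) → T M z = 0 → z = w) ∧
        ‖w - (E - T M E / deriv (T M) E)‖ ≤ C * Real.exp (-4 * k * M) := by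
  have hVc := hV.smooth.continuous
  have hdet' : (p * s - q * r : ℂ) = 1 := by exact_mod_cast hdet
  have hF : IsFundamentalPair V E p q r s u v := by
    rw [hu, hv]; exact isFundamentalPair_schrodingerSol hVc hdet' E
  obtain ⟨lam, C, hlam, hD⟩ := hF.exists_hasDichotomy hV hL
  replace hD := fun M => (hD M).mono (le_max_left C 1)
  obtain ⟨C, hC1, hD⟩ : ∃ C : ℝ, 1 ≤ C ∧ ∀ M, HasDichotomy u v C lam M :=
    ⟨max C 1, le_max_right _ _, hD⟩
  have hC0 : 0 < C := by linarith
  obtain ⟨c₀, hc₀, hsq⟩ := exists_pos_le_norm_integral_sq hF fun x => by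
    have := (conj_schrodingerSol hVc E p q x).1
    rw [Complex.conj_ofReal] at this
    rw [hu, ← this]
  have hre : ∀ z ∈ Metric.closedBall (E : ℂ) (-E / 2), z.re < 0 := fun z hz => by
    rw [Metric.mem_closedBall, dist_eq_norm] at hz
    have h1 := (le_abs_self _).trans ((Complex.abs_re_le_norm (z - E)).trans hz)
    rw [Complex.sub_re, Complex.ofReal_re] at h1
    linarith
  obtain ⟨B₀, hB₀⟩ := (isCompact_closedBall (E : ℂ) (-E / 2)).exists_bound_of_continuousOn
    (f := fun z : ℂ => (-z) ^ (1 / 2 : ℂ))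
    fun z hz => (hasDerivAt_neg_cpow_half (hre z hz)).continuousAt.continuousWithinAt
  have hEmem : (E : ℂ) ∈ Metric.closedBall (E : ℂ) (-E / 2) :=
    Metric.mem_closedBall_self (by linarith)
  obtain ⟨κ, hκ⟩ : ∃ κ, κ = (-(E : ℂ)) ^ (1 / 2 : ℂ) := ⟨_, rfl⟩
  obtain ⟨κ', hκ'⟩ : ∃ κ', κ' = deriv (fun z : ℂ => (-z) ^ (1 / 2 : ℂ)) E := ⟨_, rfl⟩
  have hκB : ‖κ‖ ≤ B₀ := hκ ▸ hB₀ _ hEmem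
  have hB₀0 : 0 ≤ B₀ := (norm_nonneg _).trans hκB
  obtain ⟨Q, hQ⟩ : ∃ Q, Q = 1 + B₀ := ⟨_, rfl⟩
  have hQ1 : 1 ≤ Q := by linarith
  have hcomb : ∀ (m a b : ℂ) (e : ℝ), ‖m‖ ≤ B₀ → ‖a‖ ≤ e → ‖b‖ ≤ e → ‖a + m * b‖ ≤ Q * e := by
    intro m a b e hm ha hb
    calc ‖a + m * b‖ ≤ ‖a‖ + ‖m‖ * ‖b‖ := (norm_add_le _ _).trans_eq (by rw [norm_mul])
      _ ≤ e + B₀ * e := by gcongr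
      _ = Q * e := by rw [hQ]; ring
  refine ⟨lam / 2, by positivity, fun δ hδ => ?_⟩
  obtain ⟨k, hk⟩ : ∃ k, k = lam / 2 := ⟨_, rfl⟩
  rw [← hk]
  have hk0 : 0 < k := by rw [hk]; positivity
  -- Chosen so that the dominant term of the derivative is at least `4 g X²`; the other terms take
  -- at most half of it.
  obtain ⟨g, hg⟩ : ∃ g, g = δ * c₀ / (4 * C) := ⟨_, rfl⟩
  have hg0 : 0 < g := by rw [hg]; positivity
  -- Each summand is one threshold to be absorbed by `A M² ≤ exp (k M)`: in order, `M² ≤ X`, the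
  -- radius condition `4 r ≤ R`, the minor terms of the derivative, and the two smallness conditions
  -- of the Newton lemma.
  obtain ⟨A, hA⟩ : ∃ A, A = 1 + 16 * C ^ 2 + (Q * C ^ 3 + ‖κ'‖ * C) / (2 * g) +
    512 * Q * C ^ 5 / g + Q * C / g := ⟨_, rfl⟩
  have hA₃ : 0 ≤ (Q * C ^ 3 + ‖κ'‖ * C) / (2 * g) := by positivity
  have hA₄ : 0 ≤ 512 * Q * C ^ 5 / g := by positivity
  have hA₅ : 0 ≤ Q * C / g := by positivity
  have hA₂ : 0 ≤ 16 * C ^ 2 := by positivity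
  obtain ⟨M₁, hM₁⟩ := eventually_atTop.1 (eventually_const_mul_sq_le_exp hk0 A)
  -- `M ≥ 1 / (-E)` keeps the ball of radius `R` in the left half-plane. The constant is what `4 L
  -- ‖T‖² / ‖T'‖³` leaves once the powers of `M` and `X` are removed.
  refine ⟨max (max M₁ 1) (max (ρ + 1) (1 / (-E))), 256 * Q ^ 3 * C ^ 7 / g ^ 3, ?_, ?_,
    fun M hM hnd => ?_⟩
  · exact lt_of_lt_of_le (by linarith) ((le_max_left (ρ + 1) _).trans (le_max_right _ _))
  · exact lt_of_lt_of_le one_pos ((le_max_right M₁ 1).trans (le_max_left _ _))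
  simp only [max_le_iff] at hM
  obtain ⟨⟨hMM₁, hM1⟩, -, hME⟩ := hM
  have hM0 : 0 < M := by linarith
  have hEM : 1 ≤ -E * M := by
    rw [div_le_iff₀ (by linarith)] at hME; linarith
  have hMsq : M ≤ M ^ 2 := by nlinarith
  have hMsq1 : 1 ≤ M ^ 2 := by nlinarith
  obtain ⟨X, hX⟩ : ∃ X, X = Real.exp (k * M) := ⟨_, rfl⟩
  have hX0 : 0 < X := hX ▸ Real.exp_pos _
  have hAX : A * M ^ 2 ≤ X := hX ▸ hM₁ M hMM₁
  have part : ∀ a, 0 ≤ a → a ≤ A → a * M ^ 2 ≤ X := fun a _ ha =>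
    (mul_le_mul_of_nonneg_right ha (by positivity)).trans hAX
  have hMX : M ^ 2 ≤ X := by simpa using part 1 zero_le_one (by linarith)
  have hX1 : 1 ≤ X := hMsq1.trans hMX
  have hXlam : Real.exp (lam * M) = X ^ 2 := by
    rw [hX, ← Real.exp_nat_mul]
    congr 1
    rw [hk]
    push_cast
    ring
  have hXlam' : Real.exp (-lam * M) = 1 / X ^ 2 := by
    rw [← hXlam, neg_mul, Real.exp_neg, one_div]
  have hXk : Real.exp (-k * M) = 1 / X := by
    rw [neg_mul, Real.exp_neg, ← hX, one_div]
  have hX4 : Real.exp (-4 * k * M) = 1 / X ^ 4 := by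
    rw [hX, ← Real.exp_nat_mul, one_div, ← Real.exp_neg]
    congr 1
    push_cast
    ring
  rw [hXk, hX4]
  have hMem : M ∈ Icc 0 M := ⟨hM0.le, le_rfl⟩
  have hDM := hD M
  have hder : HasDerivAt (T M) ((deriv u M + κ * u M) * (∫ t in (0 : ℝ)..M, v t * u t) +
      κ' * u M - (deriv v M + κ * v M) * ∫ t in (0 : ℝ)..M, u t * u t) E := by
    rw [hT]
    exact hasDerivAt_matching hVc hdet' (hre _ hEmem) hM0.le hu hv hκ hκ'
  have huM : ‖u M‖ ≤ C * (1 / X ^ 2) := hXlam' ▸ hDM.left M hMem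
  have huM' : ‖deriv u M‖ ≤ C * (1 / X ^ 2) := hXlam' ▸ hDM.left_deriv M hMem
  have hTE : ‖T M E‖ ≤ Q * (C * (1 / X ^ 2)) := by
    rw [hT]
    simp only
    rw [← hu, ← hκ]
    exact hcomb _ _ _ _ hκB huM' huM
  have hX2 : 1 / X ^ 2 ≤ 1 := by
    rw [div_le_one (by positivity)]; nlinarith
  have huv : ‖∫ t in (0 : ℝ)..M, v t * u t‖ ≤ C ^ 2 * M := by
    refine norm_integral_zero_le hM0.le fun t ht => ?_
    rw [norm_mul]
    calc _ ≤ (C * Real.exp (lam * t)) * (C * Real.exp (-lam * t)) :=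
          mul_le_mul (hDM.right t ht) (hDM.left t ht) (norm_nonneg _) (by positivity)
      _ = C ^ 2 * Real.exp (lam * t + -lam * t) := by rw [Real.exp_add]; ring
      _ = C ^ 2 := by simp
  have hlow : 2 * g * X ^ 2 ≤ ‖deriv (T M) E‖ := by
    rw [hder.deriv]
    have h1 : ‖(deriv u M + κ * u M) * (∫ t in (0 : ℝ)..M, v t * u t) + κ' * u M‖ ≤
        2 * g * X ^ 2 := by
      calc _ ≤ ‖deriv u M + κ * u M‖ * ‖∫ t in (0 : ℝ)..M, v t * u t‖ + ‖κ'‖ * ‖u M‖ :=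
            (norm_add_le _ _).trans_eq (by rw [norm_mul, norm_mul])
        _ ≤ (Q * (C * (1 / X ^ 2))) * (C ^ 2 * M) + ‖κ'‖ * (C * (1 / X ^ 2)) := by
            have := hcomb _ _ _ _ hκB huM' huM
            gcongr
        _ ≤ (Q * (C * 1)) * (C ^ 2 * M ^ 2) + ‖κ'‖ * (C * M ^ 2) := by
            have := hX2.trans hMsq1
            gcongr
        _ = (Q * C ^ 3 + ‖κ'‖ * C) / (2 * g) * M ^ 2 * (2 * g) := by
            field_simp
        _ ≤ X * (2 * g) := by
            have := part _ hA₃ (by linarith)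
            gcongr
        _ = 2 * g * (X * 1) := by ring
        _ ≤ 2 * g * (X * X) := by gcongr
        _ = _ := by ring
    have h2 : 4 * g * X ^ 2 ≤
        ‖(deriv v M + κ * v M) * ∫ t in (0 : ℝ)..M, u t * u t‖ := by
      rw [norm_mul]
      have h3 := hDM.exp_le_right hF hM0.le
      rw [hXlam] at h3
      rw [← hκ] at hnd
      calc 4 * g * X ^ 2 = δ * (X ^ 2 / C) * c₀ := by rw [hg]; field_simp
        _ ≤ δ * (‖v M‖ + ‖deriv v M‖) * c₀ := by
            gcongr
            rw [div_le_iff₀ hC0]; linarith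
        _ ≤ _ := by
            have := hsq M hM1
            gcongr
    have h3 := norm_sub_norm_le ((deriv v M + κ * v M) * ∫ t in (0 : ℝ)..M, u t * u t)
      ((deriv u M + κ * u M) * (∫ t in (0 : ℝ)..M, v t * u t) + κ' * u M)
    rw [norm_sub_rev] at h3
    linarith
  have hm0 : 0 < ‖deriv (T M) E‖ := lt_of_lt_of_le (by positivity) hlow
  -- The largest radius on which `HasDichotomy.norm_le` applies.
  obtain ⟨R, hR⟩ : ∃ R, R = 1 / (4 * C ^ 2 * M) := ⟨_, rfl⟩
  have hR0 : 0 < R := by rw [hR]; positivity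
  have hRE : R ≤ -E / 2 := by
    rw [hR, div_le_iff₀ (by positivity)]
    have : 1 ≤ C ^ 2 := by nlinarith
    nlinarith [mul_nonneg (by linarith : (0 : ℝ) ≤ C ^ 2 - 1) (by linarith : 0 ≤ -E * M)]
  have hball : ∀ z ∈ Metric.ball (E : ℂ) R, z ∈ Metric.closedBall (E : ℂ) (-E / 2) :=
    fun z hz => Metric.closedBall_subset_closedBall hRE (Metric.ball_subset_closedBall hz)
  have hTd : DifferentiableOn ℂ (T M) (Metric.ball (E : ℂ) R) := fun z hz => by
    rw [hT]
    exact (hasDerivAt_matching hVc hdet' (hre z (hball z hz)) hM0.le rfl rfl rfl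
      rfl).differentiableAt.differentiableWithinAt
  have hTB : ∀ z ∈ Metric.ball (E : ℂ) R, ‖T M z‖ ≤ Q * (2 * C * X ^ 2) := fun z hz => by
    have hz' : 4 * C ^ 2 * M * ‖z - E‖ ≤ 1 := by
      rw [Metric.mem_ball, dist_eq_norm, hR, lt_div_iff₀ (by positivity)] at hz
      linarith
    obtain ⟨h1, h2⟩ := hDM.norm_le hF hM0.le (schrodingerSol_spec hVc z p q) hz' M hMem
    rw [hXlam] at h1 h2
    rw [hT]
    exact hcomb _ _ _ _ (hB₀ z (hball z hz)) h2 h1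
  have hrR : 4 * (1 / M ^ 2 * (1 / X)) ≤ R := by
    rw [hR]
    have h1 := part _ hA₂ (by linarith)
    have h2 : 16 * C ^ 2 * M ≤ M ^ 2 * X := by
      calc 16 * C ^ 2 * M ≤ 16 * C ^ 2 * M ^ 2 := by gcongr
        _ ≤ 1 * X := by linarith
        _ ≤ M ^ 2 * X := by gcongr
    rw [show 4 * (1 / M ^ 2 * (1 / X)) = 4 / (M ^ 2 * X) by field_simp,
      div_le_div_iff₀ (by positivity) (by positivity)]
    linarith
  obtain ⟨L, hL⟩ : ∃ L, L = 16 * (Q * (2 * C * X ^ 2)) / R ^ 2 := ⟨_, rfl⟩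
  have hL' : L = 512 * Q * C ^ 5 * M ^ 2 * X ^ 2 := by
    rw [hL, hR]; field_simp; ring
  have hLr : 2 * (L * (1 / M ^ 2 * (1 / X))) ≤ ‖deriv (T M) E‖ := by
    refine le_trans ?_ hlow
    have h1 := part _ hA₄ (by linarith)
    calc 2 * (L * (1 / M ^ 2 * (1 / X))) = 2 * (512 * Q * C ^ 5 / g) * g * X := by
          rw [hL']; field_simp
      _ ≤ 2 * (512 * Q * C ^ 5 / g * M ^ 2) * g * X := by
          have : 512 * Q * C ^ 5 / g ≤ 512 * Q * C ^ 5 / g * M ^ 2 :=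
            le_mul_of_one_le_right hA₄ hMsq1
          gcongr
      _ ≤ 2 * X * g * X := by gcongr
      _ = _ := by ring
  have hfc : 2 * ‖T M E‖ ≤ ‖deriv (T M) E‖ * (1 / M ^ 2 * (1 / X)) := by
    refine le_trans ?_ (mul_le_mul_of_nonneg_right hlow (by positivity))
    have h1 := part _ hA₅ (by linarith)
    have h2 : Q * C * M ^ 2 ≤ g * X := by
      calc Q * C * M ^ 2 = g * (Q * C / g * M ^ 2) := by field_simp
        _ ≤ _ := by gcongr
    calc 2 * ‖T M E‖ ≤ 2 * (Q * (C * (1 / X ^ 2))) := by gcongr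
      _ = 2 * (Q * C * M ^ 2) / (M ^ 2 * X ^ 2) := by field_simp
      _ ≤ 2 * (g * X) / (M ^ 2 * X ^ 2) := by gcongr
      _ ≤ 2 * (g * X) * X ^ 2 / (M ^ 2 * X ^ 2) := by
          exact div_le_div_of_nonneg_right (le_mul_of_one_le_right (by positivity)
            (one_le_pow₀ hX1)) (by positivity)
      _ = _ := by field_simp
  obtain ⟨w, hw1, hw2, hw3, hw4⟩ := exists_unique_root_near hR0
    (r := 1 / M ^ 2 * (1 / X)) (by positivity) hTd hTB hL hrR hLr hfc (norm_pos_iff.1 hm0)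
  refine ⟨by linarith, hder.differentiableAt, norm_pos_iff.1 hm0, w, hw1, hw2, hw3,
    hw4.trans ?_⟩
  calc 4 * L * ‖T M E‖ ^ 2 / ‖deriv (T M) E‖ ^ 3
      ≤ 4 * L * (Q * (C * (1 / X ^ 2))) ^ 2 / (2 * g * X ^ 2) ^ 3 := by
        have : 0 ≤ L := by rw [hL']; positivity
        gcongr
    _ = 256 * Q ^ 3 * C ^ 7 / g ^ 3 * (M ^ 2 / X ^ 8) := by
        rw [hL']; field_simp; ring
    _ ≤ 256 * Q ^ 3 * C ^ 7 / g ^ 3 * (1 / X ^ 4) := by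
        have : M ^ 2 / X ^ 8 ≤ 1 / X ^ 4 := by
          rw [div_le_div_iff₀ (by positivity) (by positivity)]
          calc M ^ 2 * X ^ 4 ≤ X * X ^ 4 := by gcongr
            _ = X ^ 5 := by ring
            _ ≤ 1 * X ^ 8 := by rw [one_mul]; exact pow_le_pow_right₀ hX1 (by norm_num)
        gcongr

end TruncationTheorem

/-! ### Reality of the root and conclusion. -/

theorem mainTheorem7 (V : ℝ → ℝ) (ρ : ℝ) (hV : IsDefectPotential V ρ)
    (hEven : ∀ x, V (-x) = V x) (E : ℝ) (hE : E < 0) (Φ : ℝ → ℂ) (hΦ : IsBoundState V E Φ) :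
    ∃ k : ℝ, 0 < k ∧ ∀ δ : ℝ, 0 < δ → ∃ M₀ C : ℝ, ρ < M₀ ∧ ∀ M : ℝ, M₀ ≤ M →
      δ * (‖vSol V Φ E M‖ + ‖deriv (vSol V Φ E) M‖) ≤
        ‖deriv (vSol V Φ E) M - Complex.I * sqrtUpper E * vSol V Φ E M‖ →
      ∃ Estar : ℝ, Estar < 0 ∧
        ‖(Estar : ℂ) - E‖ ≤ 1 / M ^ 2 * Real.exp (-k * M) ∧
        Theta V Φ M Estar = 0 ∧
        (∀ z : ℂ, ‖z - E‖ ≤ 1 / M ^ 2 * Real.exp (-k * M) → Theta V Φ M z = 0 → z = Estar) ∧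
        (∃ Ψ : ℝ → ℂ, IsBoundState (truncPotential V M) Estar Ψ) ∧
        DifferentiableAt ℂ (Theta V Φ M) E ∧
        deriv (Theta V Φ M) E ≠ 0 ∧
        ‖(Estar : ℂ) - (E - Theta V Φ M E / deriv (Theta V Φ M) E)‖ ≤
          C * Real.exp (-4 * k * M) := by
  have hVc := hV.smooth.continuous
  obtain ⟨p, q, r, s, σ, hdet, hσ, hp, hq, hu, hv, hL⟩ := hΦ.exists_initial_data hVc hEven
  have hTheta : Theta V Φ = fun M z => deriv (schrodingerSol V z p q) M +
      (-z) ^ (1 / 2 : ℂ) * schrodingerSol V z p q M := by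
    funext M z
    rw [Theta_eq, hu]
  obtain ⟨k, hk, h⟩ := exists_unique_matching_root hV hdet hE rfl rfl hTheta hL
  refine ⟨k, hk, fun δ hδ => ?_⟩
  obtain ⟨M₀, C, hρ, hM₀, h⟩ := h δ hδ
  refine ⟨M₀, C, hρ, fun M hM hnd => ?_⟩
  have hv' : deriv (vSol V Φ E) M - Complex.I * sqrtUpper E * vSol V Φ E M =
      deriv (vSol V Φ E) M + (-(E : ℂ)) ^ (1 / 2 : ℂ) * vSol V Φ E M := by
    rw [sqrtUpper]
    linear_combination -((-(E : ℂ)) ^ (1 / 2 : ℂ) * vSol V Φ E M) * Complex.I_mul_I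
  rw [hv', hv] at hnd
  obtain ⟨hrE, hd, hd0, w, hw, hw0, huniq, herr⟩ := h M hM hnd
  have hwre : w.re < 0 := by
    have h1 := (le_abs_self _).trans ((Complex.abs_re_le_norm (w - E)).trans hw)
    rw [Complex.sub_re, Complex.ofReal_re] at h1
    linarith
  -- As `E`, `V` and the initial data are real, the conjugate of `w` is a root in the same ball;
  -- uniqueness makes `w` real.
  have hconj : starRingEnd ℂ w = w := by
    refine huniq _ ?_ ?_
    · rw [← Complex.conj_ofReal E, ← map_sub, Complex.norm_conj]
      exact hw
    · rw [hTheta] at hw0 ⊢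
      simp only at hw0 ⊢
      obtain ⟨h1, h2⟩ := conj_schrodingerSol hVc w p q M
      rw [h1, h2, conj_neg_cpow_half hwre, ← map_mul, ← map_add, hw0, map_zero]
  obtain ⟨e, rfl⟩ := Complex.conj_eq_iff_real.1 hconj
  rw [Complex.ofReal_re] at hwre
  refine ⟨e, hwre, hw, hw0, huniq, ?_, hd, hd0, herr⟩
  have hpC : (p : ℂ) = σ * p := by exact_mod_cast hp
  have hqC : -(q : ℂ) = σ * q := by exact_mod_cast hq
  refine exists_isBoundState_truncPotential hVc (κ := Real.sqrt (-e)) (σ := σ)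
    (schrodingerSol_spec hVc e p q) (hM₀.trans_le hM) (Real.sqrt_pos.2 (by linarith))
    (Real.sq_sqrt (by linarith)) (by rw [Complex.norm_real]; exact hσ)
    (fun x => (schrodingerSol_parity hVc hEven hpC hqC x).1)
    (fun x => (schrodingerSol_parity hVc hEven hpC hqC x).2) ?_ ?_
  · by_contra hcon
    push Not at hcon
    have h1 : p = 0 := by exact_mod_cast hcon.1
    have h2 : q = 0 := by exact_mod_cast hcon.2
    rw [h1, h2] at hdet
    norm_num at hdet
  · rw [← neg_ofReal_cpow_half hwre]
    rw [hTheta] at hw0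
    exact hw0
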